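/- For a measurable set $E\subset\mathbb R^N$ let $|E|$ be its Lebesgue measure and $P(E)=\mathcal H^{N-1}(\partial^*E)$ its perimeter in $\mathbb R^N$, where $\partial^* E$ is the reduced boundary ($P(E)=+\infty$ if $E$ does not have finite perimeter). For $k\ge 1$ and $D\subset\mathbb R^N$ let $\mathcal P_k(D)$ be the set of $k$-tuples $(\Omega_1,\dots,\Omega_k)$ of pairwise disjoint measurable subsets of $D$. For $\alpha>\frac{N-1}{N}$ consider the problem $$(1)\qquad \min\Big\{\max_{i=1,\dots,k}\frac{P(\Omega_i)}{|\Omega_i|^{\alpha}}\ :\ (\Omega_1,\dots,\Omega_k)\in\mathcal P_k(D)\Big\},$$ where the ratio is $+\infty$ if $|\Omega_i|=0$ or $P(\Omega_i)=+\infty$. **Proposition 1.3.** (i) Let $N\ge 2$, $k\ge1$, and let $D\subset\mathbb R^N$ be a bounded open set with Lipschitz boundary. Let $\alpha_n\to+\infty$ with $\alpha_n>\frac{N-1}{N}$, and for each $n$ let $(\Omega^{n}_1,\dots,\Omega^{n}_k)$ be a solution of (1) with $\alpha=\alpha_n$. Then, along a subsequence, the characteristic functions $(1_{\Omega_1^{n}},\dots,1_{\Omega_k^{n}})$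 converge in $L^1(D,\mathbb R^k)$ to $(1_{\Omega_1^\infty},\dots,1_{\Omega_k^\infty})$, where $(\Omega_1^\infty,\dots,\Omega_k^\infty)$ is a partition of $D$ into $k$ mutually disjoint measurable sets of equal measure $|D|/k$. (ii) Let $N=2$ and let $D$ be a $k$-cell, that is, a connected region which is the (interior of the) union of $k$ closed hexagons of a tiling of $\mathbb R^2$ by regular hexagons of unit area. Let $H$ be the regular hexagon of unit area. Then every sequence as in (i) has a subsequence converging as in (i) to a partition $(\Omega_1^\infty,\dots,\Omega_k^\infty)$ of $D$ into sets of equal measure with the following property. If the product-honeycomb conjecture holds for $D$, that is, $$\min\Big\{\prod_{i=1}^k \mathcal H^1(\partial^*\Omega_i)\ :\ (\Omega_i)\in\mathcal P_k(D),\ |\Omega_i|=1\ \text{for all } i\Big\}=\big(\mathcal H^1(\partial H)\big)^k,$$ then $(\Omega_1^\infty,\dots,\Omega_k^\infty)$ is optimal for this minimum problem, with the same value $\prod_{i=1}^k\mathcal H^1(\partial^*\Omega^\infty_i)=(\mathcal H^1(\partial H))^k$ as the partition of $D$ into hexagons of the tiling. In particular, if moreover partitions into hexagons of the tiling are the only optimal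 ones (up to null sets and relabelling), then $(\Omega_1^\infty,\dots,\Omega_k^\infty)$ is, up to null sets and relabelling, the partition of $D$ into those hexagons. -/

import Mathlib

open MeasureTheory Filter Topology
open scoped ENNReal NNReal InnerProductSpace

noncomputable section

/-- The divergence of a vector field on `ℝ^N`. -/
def divergence {N : ℕ} (φ : EuclideanSpace ℝ (Fin N) → EuclideanSpace ℝ (Fin N))
    (x : EuclideanSpace ℝ (Fin N)) : ℝ :=
  ∑ i, (fderiv ℝ φ x (EuclideanSpace.single i 1)) i

/-- The (De Giorgi) perimeter in `ℝ^N` of a measurable set `E`, that is, the total variation of the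
distributional gradient of its characteristic function. It is `H^{N-1}(∂* E)`, with `∂* E` the
reduced boundary, when `E` has finite perimeter, and `∞` otherwise. -/
def perimeter {N : ℕ} (E : Set (EuclideanSpace ℝ (Fin N))) : ℝ≥0∞ :=
  ⨆ (φ : EuclideanSpace ℝ (Fin N) → EuclideanSpace ℝ (Fin N))
    (_ : ContDiff ℝ 1 φ ∧ HasCompactSupport φ ∧ ∀ x, ‖φ x‖ ≤ 1),
    ENNReal.ofReal (∫ x in E, divergence φ x)

/-- The ratio `H^{N-1}(∂* E) / |E|^α`, equal to `∞` if `E` is negligible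
or does not have finite perimeter. -/
def cheegerRatio {N : ℕ} (α : ℝ) (E : Set (EuclideanSpace ℝ (Fin N))) : ℝ≥0∞ :=
  open Classical in
  if volume E = 0 then ∞ else perimeter E / volume E ^ α

/-- The class `P_k(D)` of `k`-tuples of disjoint measurable subsets of `D`. -/
def IsCluster {N k : ℕ} (D : Set (EuclideanSpace ℝ (Fin N)))
    (Ω : Fin k → Set (EuclideanSpace ℝ (Fin N))) : Prop :=
  (∀ i, Ω i ⊆ D) ∧ (∀ i j, i ≠ j → Disjoint (Ω i) (Ω j)) ∧ ∀ i, MeasurableSet (Ω i)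

/-- `Ω` solves the problem `min { max_i H^{N-1}(∂* Ω_i) / |Ω_i|^α : Ω ∈ P_k(D) }`. -/
def IsMaxSolution {N k : ℕ} (α : ℝ) (D : Set (EuclideanSpace ℝ (Fin N)))
    (Ω : Fin k → Set (EuclideanSpace ℝ (Fin N))) : Prop :=
  IsCluster D Ω ∧
    ∀ Ω' : Fin k → Set (EuclideanSpace ℝ (Fin N)), IsCluster D Ω' →
      ⨆ i, cheegerRatio α (Ω i) ≤ ⨆ i, cheegerRatio α (Ω' i)

/-- `D` is locally, up to the choice of a vertical direction `ν`, the strict epigraph of a Lipschitz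
function of the projection on the hyperplane orthogonal to `ν`. -/
def HasLipschitzBoundary {N : ℕ} (D : Set (EuclideanSpace ℝ (Fin N))) : Prop :=
  ∀ x ∈ frontier D, ∃ ν : EuclideanSpace ℝ (Fin N), ‖ν‖ = 1 ∧
    ∃ (K : ℝ≥0) (g : EuclideanSpace ℝ (Fin N) → ℝ), LipschitzWith K g ∧
      ∃ U ∈ 𝓝 x, ∀ y ∈ U, (y ∈ D ↔ g (y - ⟪ν, y⟫_ℝ • ν) < ⟪ν, y⟫_ℝ)

/-- `E` is a partition of `D` into `k` disjoint measurable sets of equal measure. -/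
def IsEqualPartition {N k : ℕ} (D : Set (EuclideanSpace ℝ (Fin N)))
    (E : Fin k → Set (EuclideanSpace ℝ (Fin N))) : Prop :=
  IsCluster D E ∧ ⋃ i, E i = D ∧ ∀ i, volume (E i) = volume D / k

/-- Convergence of the characteristic functions `(1_{Ω_1}, …, 1_{Ω_k})` in `L¹(D, ℝ^k)`. -/
def TendstoL1 {N k : ℕ} (D : Set (EuclideanSpace ℝ (Fin N)))
    (Ω : ℕ → Fin k → Set (EuclideanSpace ℝ (Fin N)))
    (E : Fin k → Set (EuclideanSpace ℝ (Fin N))) : Prop :=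
  ∀ i, Tendsto
    (fun n => eLpNorm
      (fun x => (Ω n i).indicator (fun _ => (1 : ℝ)) x - (E i).indicator (fun _ => (1 : ℝ)) x)
      1 (volume.restrict D))
    atTop (𝓝 0)

/-! Regular hexagons of unit area -/

/-- The apothem `r` of the regular hexagon of unit area: `2 √3 r² = 1`. -/
def hexApothem : ℝ := √(1 / (2 * √3))

/-- The unit vector of angle `θ + j π / 3`. -/
def hexDir (θ : ℝ) (j : ℕ) : EuclideanSpace ℝ (Fin 2) :=
  !₂[Real.cos (θ + j * (Real.pi / 3)), Real.sin (θ + j * (Real.pi / 3))]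

/-- The closed regular hexagon of unit area centred at `c`, whose sides have outer normals
`hexDir θ j` for `j = 0, …, 5`. -/
def hexagon (θ : ℝ) (c : EuclideanSpace ℝ (Fin 2)) : Set (EuclideanSpace ℝ (Fin 2)) :=
  {x | ∀ j : Fin 6, ⟪hexDir θ j, x - c⟫_ℝ ≤ hexApothem}

/-- The hexagon of index `p ∈ ℤ²` in the hexagonal tiling of the plane that contains
`hexagon θ c`. -/
def hexTile (θ : ℝ) (c : EuclideanSpace ℝ (Fin 2)) (p : ℤ × ℤ) :
    Set (EuclideanSpace ℝ (Fin 2)) :=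
  hexagon θ (c + (2 * hexApothem) • ((p.1 : ℝ) • hexDir θ 0 + (p.2 : ℝ) • hexDir θ 1))

/-- The open region formed by the hexagons with index in `s` of a hexagonal tiling. -/
def hexRegion (θ : ℝ) (c : EuclideanSpace ℝ (Fin 2)) (s : Finset (ℤ × ℤ)) :
    Set (EuclideanSpace ℝ (Fin 2)) :=
  interior (⋃ p ∈ s, hexTile θ c p)

/-- A `k`-cell: a connected region which is the union of `k` hexagons of a tiling of the plane by
regular hexagons of unit area. -/
def IsKCell (k : ℕ) (D : Set (EuclideanSpace ℝ (Fin 2))) : Prop :=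
  ∃ (θ : ℝ) (c : EuclideanSpace ℝ (Fin 2)) (s : Finset (ℤ × ℤ)),
    s.card = k ∧ D = hexRegion θ c s ∧ IsConnected D

/-- Up to null sets, `E` is the partition of `D` into hexagons of a tiling. -/
def IsHexagonalPartition {k : ℕ} (D : Set (EuclideanSpace ℝ (Fin 2)))
    (E : Fin k → Set (EuclideanSpace ℝ (Fin 2))) : Prop :=
  ∃ (θ : ℝ) (c : EuclideanSpace ℝ (Fin 2)) (s : Finset (ℤ × ℤ)) (σ : Fin k ≃ s),
    D = hexRegion θ c s ∧ ∀ i, E i =ᵐ[volume] hexTile θ c (σ i)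

/-- The length of the boundary of the regular hexagon of unit area. -/
def hexLength : ℝ≥0∞ := Measure.hausdorffMeasure 1 (frontier (hexagon 0 0))

/-- The admissible competitors of the product problem: clusters of `D` made of sets of measure 1. -/
def IsUnitCluster {k : ℕ} (D : Set (EuclideanSpace ℝ (Fin 2)))
    (Ω : Fin k → Set (EuclideanSpace ℝ (Fin 2))) : Prop :=
  IsCluster D Ω ∧ ∀ i, volume (Ω i) = 1

/-- `Ω` minimizes the product of the perimeters among the clusters of `D` made of `k` sets of
measure 1. -/
def IsProductMinimizer {k : ℕ} (D : Set (EuclideanSpace ℝ (Fin 2)))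
    (Ω : Fin k → Set (EuclideanSpace ℝ (Fin 2))) : Prop :=
  IsUnitCluster D Ω ∧
    ∀ Ω' : Fin k → Set (EuclideanSpace ℝ (Fin 2)), IsUnitCluster D Ω' →
      ∏ i, perimeter (Ω i) ≤ ∏ i, perimeter (Ω' i)

/-- The product-honeycomb property of the region `D`:
`min { ∏ H¹(∂* Ω_i) : Ω ∈ P_k(D), |Ω_i| = 1 } = H¹(∂ H)^k`. -/
def ProductHoneycomb (k : ℕ) (D : Set (EuclideanSpace ℝ (Fin 2))) : Prop :=
  IsLeast {p : ℝ≥0∞ | ∃ Ω : Fin k → Set (EuclideanSpace ℝ (Fin 2)),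
    IsUnitCluster D Ω ∧ p = ∏ i, perimeter (Ω i)} (hexLength ^ k)

end

/-! ### Perimeter: translation estimate and lower semicontinuity -/

section Perimeter

variable {N : ℕ}

/-! Fix a competitor made of k sets of common volume m = |D|/k and perimeter at most C, and put y_i
= |Ω_i|/m, so that the y_i sum to at most k. Minimality gives P(Ω_i) ≤ C y_i^α. Since D is bounded,
translating a set by more than the diameter of D yields a crude linear inequality P(Ω_i) ≥ c y_i.
Hence y_i^(α-1) ≥ c/C, so y_i ≥ (c/C)^(1/(α-1)) → 1, and the constraint on the sum forces y_i → 1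
for all i.

This does not control an individual y_i^α as α → ∞, but it does control the product: by the
arithmetic-geometric inequality ∏ y_i ≤ 1, hence ∏ P(Ω_i) ≤ C^k (∏ y_i)^α ≤ C^k with no loss in α.
As every P(Ω_i) is eventually bounded below, each is also bounded above. Compactness of sets of
bounded perimeter gives an L¹ limit, which fills D with sets of volume m, and lower semicontinuity
passes ∏ P ≤ C^k to the limit (`exists_tendstoL1_isEqualPartition`).

It remains to supply competitors. In a Lipschitz domain, D is sliced by parallel hyperplanes; the
perimeter of a slice is finite because it is bounded by the inner Minkowski content. In a k-cell,
the open tiles are used, with C = 2/r for the apothem r: then ∏ P(E_i) ≤ H¹(∂H)^k, and the honeycomb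
hypothesis is exactly the reverse inequality.

The theory of perimeter rests on one estimate, `volume_sdiff_translate_le`: moving E by h displaces
volume at most ‖h‖ P(E). It gives the linear inequality above and, by averaging over small cubes,
the compactness. -/

theorem continuous_divergence
    {φ : EuclideanSpace ℝ (Fin N) → EuclideanSpace ℝ (Fin N)} (hφ : ContDiff ℝ 1 φ) :
    Continuous (divergence φ) := by
  unfold divergence
  have h : Continuous (fderiv ℝ φ) := hφ.continuous_fderiv one_ne_zero
  refine continuous_finsetSum _ fun i _ => ?_
  have h2 : Continuous fun x => fderiv ℝ φ x (EuclideanSpace.single i 1) := h.clm_apply continuous_const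
  fun_prop

theorem hasCompactSupport_divergence
    {φ : EuclideanSpace ℝ (Fin N) → EuclideanSpace ℝ (Fin N)} (hφ : HasCompactSupport φ) :
    HasCompactSupport (divergence φ) := by
  refine (hφ.fderiv ℝ).mono fun x hx => ?_
  contrapose! hx
  have hx' : fderiv ℝ φ x = 0 := by simpa using hx
  simp [divergence, hx']

theorem divergence_const_smul (c : ℝ)
    (φ : EuclideanSpace ℝ (Fin N) → EuclideanSpace ℝ (Fin N)) (x : EuclideanSpace ℝ (Fin N)) :
    divergence (fun y => c • φ y) x = c * divergence φ x := by
  have : (fun y => c • φ y) = c • φ := rfl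
  rw [divergence, this, fderiv_const_smul_field, divergence, Finset.mul_sum]
  simp

theorem divergence_smul_const {g : EuclideanSpace ℝ (Fin N) → ℝ}
    {x : EuclideanSpace ℝ (Fin N)} (hg : DifferentiableAt ℝ g x) (h : EuclideanSpace ℝ (Fin N)) :
    divergence (fun y => g y • h) x = fderiv ℝ g x h := by
  rw [divergence, fderiv_fun_smul hg (differentiableAt_const h)]
  conv_rhs => rw [← (EuclideanSpace.basisFun (Fin N) ℝ).sum_repr h]
  simp [mul_comm]

theorem integrable_divergence
    {φ : EuclideanSpace ℝ (Fin N) → EuclideanSpace ℝ (Fin N)} (hφ : ContDiff ℝ 1 φ)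
    (hc : HasCompactSupport φ) : Integrable (divergence φ) :=
  (continuous_divergence hφ).integrable_of_hasCompactSupport (hasCompactSupport_divergence hc)

theorem ofReal_integral_divergence_le_perimeter (E : Set (EuclideanSpace ℝ (Fin N)))
    {φ : EuclideanSpace ℝ (Fin N) → EuclideanSpace ℝ (Fin N)} (hφ : ContDiff ℝ 1 φ)
    (hc : HasCompactSupport φ) (hb : ∀ x, ‖φ x‖ ≤ 1) :
    ENNReal.ofReal (∫ x in E, divergence φ x) ≤ perimeter E :=
  le_iSup₂_of_le φ ⟨hφ, hc, hb⟩ le_rfl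

theorem integral_divergence_le {E : Set (EuclideanSpace ℝ (Fin N))} (hE : perimeter E ≠ ∞)
    {φ : EuclideanSpace ℝ (Fin N) → EuclideanSpace ℝ (Fin N)} (hφ : ContDiff ℝ 1 φ)
    (hc : HasCompactSupport φ) {L : ℝ} (hL : 0 < L) (hb : ∀ x, ‖φ x‖ ≤ L) :
    ∫ x in E, divergence φ x ≤ L * (perimeter E).toReal := by
  have h := ofReal_integral_divergence_le_perimeter E (φ := fun x => L⁻¹ • φ x)
    (hφ.const_smul L⁻¹) (hc.smul_left (f := fun _ => L⁻¹)) (fun x => by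
      rw [norm_smul, Real.norm_of_nonneg (by positivity), inv_mul_le_iff₀ hL]; simpa using hb x)
  simp_rw [divergence_const_smul, integral_const_mul] at h
  rw [← ENNReal.ofReal_toReal hE, ENNReal.ofReal_le_ofReal_iff ENNReal.toReal_nonneg,
    inv_mul_le_iff₀ hL] at h
  exact h

/-- Inner and outer regularity sandwich A between a compact K and an open U, and a smooth Urysohn
function interpolates. -/
theorem exists_contDiff_indicator_approx {A : Set (EuclideanSpace ℝ (Fin N))}
    (hA : MeasurableSet A) (hA' : volume A ≠ ∞) {η : ℝ} (hη : 0 < η) :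
    ∃ (g : EuclideanSpace ℝ (Fin N) → ℝ) (K U : Set (EuclideanSpace ℝ (Fin N))),
      ContDiff ℝ 1 g ∧ HasCompactSupport g ∧ (∀ x, g x ∈ Set.Icc 0 1) ∧
      MeasurableSet K ∧ MeasurableSet U ∧ K ⊆ A ∧ A ⊆ U ∧ volume U ≠ ∞ ∧
      (∀ x ∈ K, g x = 1) ∧ (∀ x ∉ U, g x = 0) ∧ volume.real (U \ K) ≤ η := by
  have hη2 : ENNReal.ofReal (η / 2) ≠ 0 := by simpa using hη
  obtain ⟨U, hAU, hUo, hUlt⟩ := A.exists_isOpen_lt_add hA' hη2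
  obtain ⟨K, hKA, hK, hKlt⟩ := hA.exists_isCompact_lt_add hA' hη2
  have hUfin : volume U ≠ ∞ := (hUlt.trans (by finiteness)).ne
  obtain ⟨R, hR⟩ := hK.isBounded.subset_ball 0
  -- U may be unbounded; intersecting it with a ball containing K makes the support of g compact.
  obtain ⟨g, hg, hr, hs, h1⟩ := exists_contMDiff_support_eq_eq_one_iff
    (n := 1) (modelWithCornersSelf ℝ (EuclideanSpace ℝ (Fin N))) (hUo.inter (Metric.isOpen_ball (x := 0) (ε := R)))
    hK.isClosed (Set.subset_inter (hKA.trans hAU) hR)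
  refine ⟨g, K, U, hg.contDiff, ?_, fun x => hr ⟨x, rfl⟩, hK.measurableSet, hUo.measurableSet, hKA,
    hAU, hUfin, fun x hx => (h1 x).1 hx, fun x hx => ?_, ?_⟩
  · refine HasCompactSupport.of_support_subset_isCompact (isCompact_closedBall 0 R) ?_
    rw [hs]
    exact Set.inter_subset_right.trans Metric.ball_subset_closedBall
  · by_contra hne
    have : x ∈ Function.support g := hne
    rw [hs] at this
    exact hx this.1
  · have hKfin : volume K ≠ ∞ := hK.measure_lt_top.ne
    rw [measureReal_def]
    refine ENNReal.toReal_le_of_le_ofReal hη.le ?_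
    rw [measure_sdiff (hKA.trans hAU) hK.measurableSet.nullMeasurableSet hKfin]
    rw [tsub_le_iff_right]
    calc volume U ≤ volume A + ENNReal.ofReal (η / 2) := hUlt.le
      _ ≤ (volume K + ENNReal.ofReal (η / 2)) + ENNReal.ofReal (η / 2) := by gcongr
      _ = ENNReal.ofReal η + volume K := by
        rw [add_assoc, ← ENNReal.ofReal_add (by positivity) (by positivity), add_halves, add_comm]

/-- Write g(x + h) - g(x) as the integral over t in [0, 1] of the derivative along h at x + th, and
exchange integrals. For fixed t the integrand is the divergence of the field g(· + th) h, whose norm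
is at most ‖h‖. -/
theorem integral_sub_comp_sub_le {E : Set (EuclideanSpace ℝ (Fin N))} (hE : perimeter E ≠ ∞)
    {g : EuclideanSpace ℝ (Fin N) → ℝ} (hg : ContDiff ℝ 1 g) (hc : HasCompactSupport g)
    (hb : ∀ x, ‖g x‖ ≤ 1) {h : EuclideanSpace ℝ (Fin N)} (hh : h ≠ 0) :
    ∫ x in E, (g (x + h) - g x) ≤ ‖h‖ * (perimeter E).toReal := by
  have hpos : 0 < ‖h‖ := norm_pos_iff.2 hh
  have hgd : Differentiable ℝ g := hg.differentiable one_ne_zero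
  have hcont : Continuous fun p : ℝ × EuclideanSpace ℝ (Fin N) => fderiv ℝ g (p.2 + p.1 • h) h := by
    have := hg.continuous_fderiv one_ne_zero
    exact (this.comp (by fun_prop)).clm_apply continuous_const
  have hderiv : ∀ x, ∀ t : ℝ, HasDerivAt (fun t : ℝ => g (x + t • h)) (fderiv ℝ g (x + t • h) h) t := by
    intro x t
    have h1 : HasDerivAt (fun t : ℝ => x + t • h) h t := by
      simpa using ((hasDerivAt_id t).smul_const h).const_add x
    exact (hgd _).hasFDerivAt.comp_hasDerivAt t h1
  have hFTC : ∀ x, g (x + h) - g x = ∫ t in (0 : ℝ)..1, fderiv ℝ g (x + t • h) h := by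
    intro x
    rw [intervalIntegral.integral_eq_sub_of_hasDerivAt (fun t _ => hderiv x t)]
    · simp
    · exact (hcont.comp (by fun_prop : Continuous fun t : ℝ => (t, x))).intervalIntegrable _ _
  have hint : Integrable (Function.uncurry fun (t : ℝ) (x : EuclideanSpace ℝ (Fin N)) =>
      fderiv ℝ g (x + t • h) h) ((volume.restrict (Set.uIoc (0:ℝ) 1)).prod (volume.restrict E)) := by
    -- For t in [0, 1] the integrand vanishes in x outside the compact set of points z - th with z
    -- in the support of g.
    obtain ⟨K, hK, hKeq⟩ : ∃ K, IsCompact K ∧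
        (fun p : EuclideanSpace ℝ (Fin N) × ℝ => p.1 - p.2 • h) ''
          (tsupport g ×ˢ Set.Icc (0:ℝ) 1) = K :=
      ⟨_, (hc.isCompact.prod isCompact_Icc).image (by fun_prop), rfl⟩
    have h3 : IntegrableOn (Function.uncurry fun (t : ℝ) (x : EuclideanSpace ℝ (Fin N)) =>
        fderiv ℝ g (x + t • h) h) (Set.Icc (0:ℝ) 1 ×ˢ K) (volume.prod volume) :=
      ContinuousOn.integrableOn_compact (isCompact_Icc.prod hK) hcont.continuousOn
    have h4 : IntegrableOn (Function.uncurry fun (t : ℝ) (x : EuclideanSpace ℝ (Fin N)) =>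
        fderiv ℝ g (x + t • h) h) (Set.Icc (0:ℝ) 1 ×ˢ Set.univ) (volume.prod volume) := by
      refine h3.of_forall_sdiff_eq_zero (measurableSet_Icc.prod MeasurableSet.univ) ?_
      rintro ⟨t, x⟩ ⟨⟨ht, -⟩, hn⟩
      by_contra hne
      refine hn ⟨ht, hKeq ▸ ⟨(x + t • h, t), ⟨?_, ht⟩, by simp⟩⟩
      by_contra hn
      have := image_eq_zero_of_notMem_tsupport (f := fderiv ℝ g) (x := x + t • h)
        (fun h5 => hn (tsupport_fderiv_subset ℝ h5))
      exact hne (by simp [Function.uncurry, this])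
    rw [Measure.prod_restrict]
    refine h4.mono_set (Set.prod_mono ?_ (Set.subset_univ _))
    rw [Set.uIoc_of_le zero_le_one]
    exact Set.Ioc_subset_Icc_self
  simp_rw [hFTC]
  rw [← intervalIntegral_integral_swap hint]
  have hb' : ∀ t ∈ Set.Icc (0:ℝ) 1, ∫ x in E, fderiv ℝ g (x + t • h) h ≤ ‖h‖ * (perimeter E).toReal := by
    intro t _
    have hgt : ContDiff ℝ 1 fun x => g (x + t • h) := hg.comp (contDiff_id.add contDiff_const)
    have hct : HasCompactSupport fun x => g (x + t • h) :=
      hc.comp_homeomorph (Homeomorph.addRight (t • h))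
    have := integral_divergence_le hE (φ := fun x => g (x + t • h) • h) (hgt.smul contDiff_const)
      hct.smul_right hpos (fun x => by
        rw [norm_smul]; exact mul_le_of_le_one_left hpos.le (hb _))
    convert this using 2
    ext x
    rw [divergence_smul_const (hgt.differentiable one_ne_zero x) h, fderiv_comp_add_right]
  rw [intervalIntegral.integral_of_le zero_le_one]
  have h6 : ‖h‖ * (perimeter E).toReal = ∫ t in Set.Ioc (0:ℝ) 1, ‖h‖ * (perimeter E).toReal := by simp
  rw [h6]
  refine setIntegral_mono_on ?_ (integrableOn_const (by simp)) measurableSet_Ioc fun t ht => hb' t ⟨ht.1.le, ht.2⟩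
  have := hint.integral_prod_left
  rwa [Set.uIoc_of_le zero_le_one] at this

/-- With E' = E + h, the set in question is a translate of E' \ E. Testing with a smooth g close to
the indicator of E' \ E, the integral of g(x + h) - g(x) over E equals ∫_{E'} g - ∫_E g, which is
nearly |E' \ E|. -/
theorem volume_sdiff_translate_le {E : Set (EuclideanSpace ℝ (Fin N))} (hEm : MeasurableSet E)
    (hEv : volume E ≠ ∞) (hE : perimeter E ≠ ∞) (h : EuclideanSpace ℝ (Fin N)) :
    volume {x | x ∈ E ∧ x + h ∉ E} ≤ ENNReal.ofReal ‖h‖ * perimeter E := by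
  rcases eq_or_ne h 0 with rfl | hh
  · simp
  set E' : Set (EuclideanSpace ℝ (Fin N)) := (fun x => x - h) ⁻¹' E with hE'
  have hE'm : MeasurableSet E' := hEm.preimage (by fun_prop)
  have hE'v : volume E' = volume E := by
    simp only [hE', sub_eq_add_neg]; exact measure_preimage_add_right _ _ _
  have hAB : volume {x | x ∈ E ∧ x + h ∉ E} = volume (E' \ E) := by
    rw [← measure_preimage_add_right volume h (E' \ E)]
    congr 1
    ext x
    simp [hE']
  have hBfin : volume (E' \ E) ≠ ∞ :=
    ((measure_mono Set.sdiff_subset).trans_lt (hE'v ▸ hEv.lt_top)).ne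
  rw [hAB, ← ENNReal.ofReal_toReal hE, ← ENNReal.ofReal_mul (norm_nonneg _),
    ← ENNReal.ofReal_toReal hBfin]
  refine ENNReal.ofReal_le_ofReal (le_of_forall_pos_le_add fun η hη => ?_)
  -- The error |U \ K| is paid twice, once below the integral and once in |E' \ E| ≤ |K| + |U \ K|,
  -- hence η/2.
  obtain ⟨g, K, U, hg, hc, h01, hKm, hUm, hKB, hBU, hUfin, hK1, hU0, hUK⟩ :=
    exists_contDiff_indicator_approx (hE'm.diff hEm) hBfin (half_pos hη)
  have hgi : Integrable g := hg.continuous.integrable_of_hasCompactSupport hc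
  have hmain := integral_sub_comp_sub_le hE hg hc
    (fun x => by rw [Real.norm_of_nonneg (h01 x).1]; exact (h01 x).2) hh
  have hKfin : volume K ≠ ∞ := measure_ne_top_of_subset (hKB.trans hBU) hUfin
  have hUKfin : volume (U \ K) ≠ ∞ := measure_ne_top_of_subset Set.sdiff_subset hUfin
  have heq : ∫ x in E, (g (x + h) - g x) = ∫ x, (E'.indicator g x - E.indicator g x) := by
    rw [integral_sub (hgi.comp_add_right h).integrableOn hgi.integrableOn,
      integral_sub (hgi.indicator hE'm) (hgi.indicator hEm), integral_indicator hEm,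
      ← integral_indicator hEm, ← integral_add_right_eq_self (E'.indicator g) h]
    congr 2
    ext x
    have hiff : x + h ∈ E' ↔ x ∈ E := by simp [E']
    by_cases hx : x ∈ E
    · rw [Set.indicator_of_mem hx, Set.indicator_of_mem (hiff.2 hx)]
    · rw [Set.indicator_of_notMem hx, Set.indicator_of_notMem (fun h => hx (hiff.1 h))]
  have hlow : volume.real K - volume.real (U \ K) ≤ ∫ x, (E'.indicator g x - E.indicator g x) := by
    have h1 : Integrable (K.indicator (fun _ => (1:ℝ))) :=
      (integrable_indicator_iff hKm).2 (integrableOn_const hKfin)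
    have h2 : Integrable ((U \ K).indicator (fun _ => (1:ℝ))) :=
      (integrable_indicator_iff (hUm.diff hKm)).2 (integrableOn_const hUKfin)
    have h3 : volume.real K - volume.real (U \ K) =
        ∫ x, (K.indicator (fun _ => (1:ℝ)) x - (U \ K).indicator (fun _ => (1:ℝ)) x) := by
      rw [integral_sub h1 h2, integral_indicator hKm, integral_indicator (hUm.diff hKm)]
      simp
    rw [h3]
    refine integral_mono (h1.sub h2) ((hgi.indicator hE'm).sub (hgi.indicator hEm)) fun x => ?_
    have hx := h01 x
    by_cases hxK : x ∈ K
    · have := hKB hxK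
      simp [hxK, this.1, this.2, hK1 x hxK]
    · by_cases hxU : x ∈ U
      · by_cases h5 : x ∈ E' <;> by_cases h6 : x ∈ E <;> simp [hxK, hxU, h5, h6] <;> linarith [hx.1, hx.2]
      · simp [Set.indicator, hxK, hxU, hU0 x hxU]
  have hUle : volume.real (E' \ E) ≤ volume.real K + volume.real (U \ K) := by
    rw [← measureReal_union Set.disjoint_sdiff_right (hUm.diff hKm) hKfin hUKfin]
    exact measureReal_mono (fun x hx => by by_cases hxK : x ∈ K <;> simp [hxK, hBU hx])
      (by finiteness)
  rw [← measureReal_def]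
  linarith

/-- A translation by 2R + 1, more than the diameter of the ball, moves E off itself, so the
displaced volume is all of |E|. This linear substitute for the isoperimetric inequality is enough
here. -/
theorem volume_le_mul_perimeter {E : Set (EuclideanSpace ℝ (Fin N))} (hEm : MeasurableSet E)
    (hE : perimeter E ≠ ∞) {R : ℝ} (hN : 0 < N) (hR : 0 ≤ R) (hER : E ⊆ Metric.closedBall 0 R) :
    volume E ≤ ENNReal.ofReal (2 * R + 1) * perimeter E := by
  have hEv : volume E ≠ ∞ := measure_ne_top_of_subset hER (measure_closedBall_lt_top).ne
  have hn : ‖EuclideanSpace.single (⟨0, hN⟩ : Fin N) (2 * R + 1)‖ = 2 * R + 1 := by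
    rw [PiLp.norm_single, Real.norm_of_nonneg (by positivity)]
  have := volume_sdiff_translate_le hEm hEv hE (EuclideanSpace.single (⟨0, hN⟩ : Fin N) (2 * R + 1))
  rw [hn] at this
  refine (measure_mono (t := {x | x ∈ E ∧ _ ∉ E}) fun x hx => ⟨hx, fun hx' => ?_⟩).trans this
  have h1 := hER hx
  have h2 := hER hx'
  rw [mem_closedBall_zero_iff] at h1 h2
  have h3 := norm_sub_le (x + EuclideanSpace.single (⟨0, hN⟩ : Fin N) (2 * R + 1)) x
  rw [add_sub_cancel_left, hn] at h3
  linarith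

/-- Lower semicontinuity of the perimeter. -/
theorem perimeter_le_liminf {ι : Type*} {l : Filter ι}
    {E : Set (EuclideanSpace ℝ (Fin N))} {F : ι → Set (EuclideanSpace ℝ (Fin N))}
    (h : ∀ ψ : EuclideanSpace ℝ (Fin N) → ℝ, Continuous ψ → HasCompactSupport ψ →
      Tendsto (fun n => ∫ x in F n, ψ x) l (𝓝 (∫ x in E, ψ x))) :
    perimeter E ≤ liminf (fun n => perimeter (F n)) l := by
  rcases l.eq_or_neBot with rfl | hl
  · simp
  refine iSup₂_le fun φ hφ => ?_
  have h1 := ENNReal.tendsto_ofReal (h _ (continuous_divergence hφ.1) (hasCompactSupport_divergence hφ.2.1))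
  rw [← h1.liminf_eq]
  exact liminf_le_liminf (Eventually.of_forall fun n =>
    ofReal_integral_divergence_le_perimeter _ hφ.1 hφ.2.1 hφ.2.2)

theorem tendsto_setIntegral_of_eLpNorm_indicator_sub {ι : Type*} {l : Filter ι}
    {E : Set (EuclideanSpace ℝ (Fin N))} {F : ι → Set (EuclideanSpace ℝ (Fin N))}
    (hE : MeasurableSet E) (hF : ∀ n, MeasurableSet (F n))
    (hEF : Tendsto (fun n => eLpNorm (fun x => (F n).indicator (fun _ => (1 : ℝ)) x -
      E.indicator (fun _ => (1 : ℝ)) x) 1 volume) l (𝓝 0))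
    {ψ : EuclideanSpace ℝ (Fin N) → ℝ} (hψ : Continuous ψ) (hc : HasCompactSupport ψ) :
    Tendsto (fun n => ∫ x in F n, ψ x) l (𝓝 (∫ x in E, ψ x)) := by
  have hψi : Integrable ψ := hψ.integrable_of_hasCompactSupport hc
  obtain ⟨M, hM⟩ := hψ.bounded_above_of_compact_support hc
  simp_rw [← integral_indicator hE, ← integral_indicator (hF _)]
  refine tendsto_integral_of_L1 _ (hψi.indicator hE).aestronglyMeasurable (Eventually.of_forall fun n => hψi.indicator (hF n)) ?_
  have h0 : Tendsto (fun n => ENNReal.ofReal M * eLpNorm (fun x => (F n).indicator (fun _ => (1 : ℝ)) x -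
      E.indicator (fun _ => (1 : ℝ)) x) 1 volume) l (𝓝 0) := by
    simpa using ENNReal.Tendsto.const_mul hEF (Or.inr ENNReal.ofReal_ne_top)
  refine tendsto_of_tendsto_of_tendsto_of_le_of_le tendsto_const_nhds h0 (fun _ => zero_le) fun n => ?_
  simp only [eLpNorm_one_eq_lintegral_enorm]
  rw [← lintegral_const_mul' _ _ ENNReal.ofReal_ne_top]
  refine lintegral_mono fun x => ?_
  have h1 : (F n).indicator ψ x - E.indicator ψ x = ψ x * ((F n).indicator (fun _ => (1 : ℝ)) x -
      E.indicator (fun _ => (1 : ℝ)) x) := by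
    by_cases h5 : x ∈ F n <;> by_cases h6 : x ∈ E <;> simp [h5, h6]
  rw [h1, enorm_mul]
  gcongr
  rw [← ofReal_norm]
  exact ENNReal.ofReal_le_ofReal (hM x)

end Perimeter

/-! ### L¹ compactness of bounded sets of bounded perimeter -/

section Compactness

variable {N : ℕ}

/-- The half-open cube of index `z` in the grid of mesh `δ`. -/
def gridCube (δ : ℝ) (z : Fin N → ℤ) : Set (EuclideanSpace ℝ (Fin N)) :=
  {x | ∀ i, ⌊x i / δ⌋ = z i}

theorem measurableSet_gridCube (δ : ℝ) (z : Fin N → ℤ) : MeasurableSet (gridCube δ z) := by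
  have : gridCube δ z = ⋂ i, (fun x : EuclideanSpace ℝ (Fin N) => ⌊x i / δ⌋) ⁻¹' {z i} := by
    ext; simp [gridCube]
  rw [this]
  exact MeasurableSet.iInter fun i =>
    (Int.measurable_floor.comp (by fun_prop : Measurable fun x : EuclideanSpace ℝ (Fin N) => x i / δ))
      (measurableSet_singleton _)

theorem disjoint_gridCube (δ : ℝ) {z w : Fin N → ℤ} (h : z ≠ w) :
    Disjoint (gridCube δ z) (gridCube δ w) :=
  Set.disjoint_left.2 fun _ hz hw => h (funext fun i => (hz i).symm.trans (hw i))

theorem volume_gridCube {δ : ℝ} (hδ : 0 < δ) (z : Fin N → ℤ) :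
    volume (gridCube δ z) = ENNReal.ofReal δ ^ N := by
  have : gridCube δ z = (WithLp.ofLp) ⁻¹'
      (Set.univ.pi fun i => Set.Ico ((z i : ℝ) * δ) ((z i : ℝ) * δ + δ)) := by
    ext x
    simp only [gridCube, Set.mem_ofPred_eq, Set.mem_preimage, Set.mem_univ_pi, Set.mem_Ico]
    refine forall_congr' fun i => ?_
    rw [Int.floor_eq_iff, le_div_iff₀ hδ, div_lt_iff₀ hδ, add_mul, one_mul]
  rw [this, (PiLp.volume_preserving_ofLp (Fin N)).measure_preimage
    (MeasurableSet.univ_pi fun _ => measurableSet_Ico).nullMeasurableSet, Real.volume_pi_Ico]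
  simp

theorem norm_sub_le_of_mem_gridCube {δ : ℝ} (hδ : 0 < δ) {z : Fin N → ℤ}
    {x y : EuclideanSpace ℝ (Fin N)} (hx : x ∈ gridCube δ z) (hy : y ∈ gridCube δ z) :
    ‖y - x‖ ≤ √N * δ := by
  have h : ∀ i, |(y - x) i| ≤ δ := by
    intro i
    have h1 := Int.floor_eq_iff.1 (hx i)
    have h2 := Int.floor_eq_iff.1 (hy i)
    rw [le_div_iff₀ hδ, div_lt_iff₀ hδ] at h1 h2
    rw [abs_le]
    simp only [PiLp.sub_apply]
    constructor <;> nlinarith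
  rw [EuclideanSpace.norm_eq]
  calc √(∑ i, ‖(y - x) i‖ ^ 2) ≤ √(∑ _i : Fin N, δ ^ 2) := by
        refine Real.sqrt_le_sqrt (Finset.sum_le_sum fun i _ => ?_)
        exact pow_le_pow_left₀ (norm_nonneg _) (h i) 2
    _ = √N * δ := by
        rw [Finset.sum_const, Finset.card_univ, Fintype.card_fin, nsmul_eq_mul,
          Real.sqrt_mul (Nat.cast_nonneg _), Real.sqrt_sq hδ.le]

/-- The products are volumes of disjoint pieces of the set of pairs (x, y) with x ∈ E, y ∉ E, |y -
x| ≤ ρ. In the variables x and h = y - x, each slice at fixed h has volume at most ‖h‖ P(E) by the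
translation estimate. -/
theorem sum_volume_inter_mul_volume_sdiff_le {ι : Type*} (Z : Finset ι)
    {Q : ι → Set (EuclideanSpace ℝ (Fin N))} (hQm : ∀ z, MeasurableSet (Q z))
    (hQd : ∀ z w, z ≠ w → Disjoint (Q z) (Q w)) {ρ : ℝ}
    (hQ : ∀ z, ∀ x ∈ Q z, ∀ y ∈ Q z, ‖y - x‖ ≤ ρ)
    {E : Set (EuclideanSpace ℝ (Fin N))} (hEm : MeasurableSet E)
    (hEv : volume E ≠ ∞) (hE : perimeter E ≠ ∞) :
    ∑ z ∈ Z, volume (E ∩ Q z) * volume (Q z \ E) ≤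
      volume (Metric.closedBall (0 : EuclideanSpace ℝ (Fin N)) ρ) *
        (ENNReal.ofReal ρ * perimeter E) := by
  set W : Set (EuclideanSpace ℝ (Fin N) × EuclideanSpace ℝ (Fin N)) :=
    {p | p.1 ∈ E ∧ p.2 ∉ E ∧ ‖p.2 - p.1‖ ≤ ρ} with hW
  have hWm : MeasurableSet W := by
    have h1 : MeasurableSet {p : EuclideanSpace ℝ (Fin N) × EuclideanSpace ℝ (Fin N) | ‖p.2 - p.1‖ ≤ ρ} :=
      measurableSet_le (by fun_prop) (by fun_prop)
    exact (measurable_fst hEm).inter ((measurable_snd hEm.compl).inter h1)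
  have h1 : ∑ z ∈ Z, volume (E ∩ Q z) * volume (Q z \ E) =
      (volume.prod volume) (⋃ z ∈ Z, (E ∩ Q z) ×ˢ (Q z \ E)) := by
    rw [measure_biUnion_finset]
    · simp_rw [Measure.prod_prod]
    · intro z _ w _ hzw
      refine Set.disjoint_left.2 fun p hp hp' => ?_
      exact Set.disjoint_left.1 (hQd z w hzw) hp.1.2 hp'.1.2
    · exact fun z _ => (hEm.inter (hQm z)).prod ((hQm z).diff hEm)
  have h2 : (⋃ z ∈ Z, (E ∩ Q z) ×ˢ (Q z \ E)) ⊆ W := by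
    refine Set.iUnion₂_subset fun z _ p hp => ⟨hp.1.1, hp.2.2, hQ z _ hp.1.2 _ hp.2.1⟩
  rw [h1]
  refine (measure_mono h2).trans ?_
  rw [← (measurePreserving_prod_add volume volume).measure_preimage hWm.nullMeasurableSet,
    Measure.prod_apply_symm (hWm.preimage (by fun_prop))]
  calc _ ≤ ∫⁻ h, (Metric.closedBall (0 : EuclideanSpace ℝ (Fin N)) ρ).indicator
          (fun _ => ENNReal.ofReal ρ * perimeter E) h := by
        refine lintegral_mono fun h => ?_
        by_cases hh : h ∈ Metric.closedBall (0 : EuclideanSpace ℝ (Fin N)) ρ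
        · rw [Set.indicator_of_mem hh]
          refine (measure_mono (t := {x | x ∈ E ∧ x + h ∉ E}) fun x hx => ⟨hx.1, hx.2.1⟩).trans ?_
          refine (volume_sdiff_translate_le hEm hEv hE h).trans ?_
          gcongr
          exact mem_closedBall_zero_iff.1 hh
        · rw [Set.indicator_of_notMem hh, nonpos_iff_eq_zero]
          convert measure_empty (μ := (volume : Measure (EuclideanSpace ℝ (Fin N))))
          refine Set.eq_empty_of_forall_notMem fun x hx => hh ?_
          simpa using hx.2.2
    _ = _ := by rw [lintegral_indicator_const measurableSet_closedBall, mul_comm]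

theorem indicatorConstLp_biUnion_finset {X ι : Type*} [MeasurableSpace X] {μ : Measure X}
    {A : ι → Set X} (hm : ∀ z, MeasurableSet (A z)) (hf : ∀ z, μ (A z) ≠ ∞)
    (hd : ∀ z w, z ≠ w → Disjoint (A z) (A w)) (Z : Finset ι) :
    ∀ {B : Set X} (hB : MeasurableSet B) (hBf : μ B ≠ ∞), B = ⋃ z ∈ Z, A z →
      indicatorConstLp 1 hB hBf (1 : ℝ) = ∑ z ∈ Z, indicatorConstLp 1 (hm z) (hf z) (1 : ℝ) := by
  classical
  induction Z using Finset.induction_on with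
  | empty =>
    rintro B hB hBf rfl'
    have : B = ∅ := by simpa using rfl'
    subst this
    simp
  | insert z Z hz ih =>
    intro B hB hBf hBe
    rw [Finset.set_biUnion_insert] at hBe
    subst hBe
    have hZm : MeasurableSet (⋃ z ∈ Z, A z) := Z.measurableSet_biUnion fun z _ => hm z
    have hZf : μ (⋃ z ∈ Z, A z) ≠ ∞ := measure_ne_top_of_subset Set.subset_union_right hBf
    rw [Finset.sum_insert hz, ← ih hZm hZf rfl, ← indicatorConstLp_disjoint_union]
    refine Set.disjoint_iUnion₂_right.2 fun w hw => hd z w ?_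
    rintro rfl
    exact hz hw

/-- Poincaré-type computation on one cell: with a the density of E in Q, the distance from the
indicator to its mean is (1 - a)|E ∩ Q| + a|Q \ E|. -/
theorem norm_indicatorConstLp_inter_sub_le {X : Type*} [MeasurableSpace X] {μ : Measure X}
    {E Q : Set X} (hE : MeasurableSet E) (hQ : MeasurableSet Q) (hQf : μ Q ≠ ∞) (hQ0 : μ Q ≠ 0) :
    ‖indicatorConstLp 1 (hE.inter hQ) (measure_ne_top_of_subset Set.inter_subset_right hQf) (1 : ℝ)
      - (μ.real (E ∩ Q) / μ.real Q) • indicatorConstLp 1 hQ hQf (1 : ℝ)‖ ≤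
      2 * (μ.real (E ∩ Q) * μ.real (Q \ E)) / μ.real Q := by
  have h1f : μ (E ∩ Q) ≠ ∞ := measure_ne_top_of_subset Set.inter_subset_right hQf
  have h2f : μ (Q \ E) ≠ ∞ := measure_ne_top_of_subset Set.sdiff_subset hQf
  have hpos : 0 < μ.real Q := ENNReal.toReal_pos hQ0 hQf
  have hsum : μ.real (E ∩ Q) + μ.real (Q \ E) = μ.real Q := by
    rw [Set.inter_comm]
    exact measureReal_inter_add_sdiff hE
  have hQe : indicatorConstLp 1 hQ hQf (1 : ℝ) =
      indicatorConstLp 1 (hE.inter hQ) h1f (1 : ℝ) + indicatorConstLp 1 (hQ.diff hE) h2f (1 : ℝ) := by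
    rw [← indicatorConstLp_disjoint_union]
    · congr 1
      rw [Set.inter_comm, Set.inter_union_sdiff]
    · exact Set.disjoint_left.2 fun x hx hx' => hx'.2 hx.1
  set a := μ.real (E ∩ Q) / μ.real Q with ha
  have ha1 : 1 - a = μ.real (Q \ E) / μ.real Q := by
    rw [ha, eq_div_iff hpos.ne', sub_mul, div_mul_cancel₀ _ hpos.ne']; linarith
  have : indicatorConstLp 1 (hE.inter hQ) h1f (1 : ℝ) - a • indicatorConstLp 1 hQ hQf (1 : ℝ) =
      (1 - a) • indicatorConstLp 1 (hE.inter hQ) h1f (1 : ℝ) -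
        a • indicatorConstLp 1 (hQ.diff hE) h2f (1 : ℝ) := by
    rw [hQe]; module
  rw [this]
  refine (norm_sub_le _ _).trans ?_
  rw [norm_smul, norm_smul, norm_indicatorConstLp one_ne_zero ENNReal.one_ne_top,
    norm_indicatorConstLp one_ne_zero ENNReal.one_ne_top, ha1, ha,
    Real.norm_of_nonneg (div_nonneg measureReal_nonneg measureReal_nonneg),
    Real.norm_of_nonneg (div_nonneg measureReal_nonneg measureReal_nonneg)]
  simp only [ENNReal.toReal_one, div_one, Real.rpow_one]
  rw [Real.norm_of_nonneg (zero_le_one' ℝ)]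
  apply le_of_eq
  ring

theorem totallyBounded_of_forall_exists_dist_lt {X : Type*} [PseudoMetricSpace X] {S : Set X}
    (h : ∀ ε > 0, ∃ T : Set X, TotallyBounded T ∧ ∀ x ∈ S, ∃ y ∈ T, dist x y < ε) :
    TotallyBounded S := by
  rw [Metric.totallyBounded_iff]
  intro ε hε
  obtain ⟨T, hT, hST⟩ := h (ε / 2) (half_pos hε)
  obtain ⟨t, ht, hTt⟩ := Metric.totallyBounded_iff.1 hT (ε / 2) (half_pos hε)
  refine ⟨t, ht, fun x hx => ?_⟩
  obtain ⟨y, hy, hxy⟩ := hST x hx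
  obtain ⟨z, hz, hyz⟩ := Set.mem_iUnion₂.1 (hTt hy)
  refine Set.mem_iUnion₂.2 ⟨z, hz, ?_⟩
  rw [Metric.mem_ball] at hyz ⊢
  linarith [dist_triangle x y z]

theorem exists_finset_subset_iUnion_gridCube {δ : ℝ} (hδ : 0 < δ) (R : ℝ) :
    ∃ Z : Finset (Fin N → ℤ),
      Metric.closedBall (0 : EuclideanSpace ℝ (Fin N)) R ⊆ ⋃ z ∈ Z, gridCube δ z := by
  refine ⟨Fintype.piFinset fun _ => Finset.Icc ⌊-R / δ⌋ ⌊R / δ⌋, fun x hx => ?_⟩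
  refine Set.mem_iUnion₂.2 ⟨fun i => ⌊x i / δ⌋, ?_, fun i => rfl⟩
  rw [Fintype.mem_piFinset]
  intro i
  have h1 : |x i| ≤ R := (PiLp.norm_apply_le x i).trans (mem_closedBall_zero_iff.1 hx)
  rw [abs_le] at h1
  rw [Finset.mem_Icc]
  exact ⟨Int.floor_mono (by gcongr; exact h1.1), Int.floor_mono (by gcongr; exact h1.2)⟩

/-- Replace the indicator of E by its averages on cubes of side δ. The step functions with values in
[0, 1] on finitely many cubes form a compact family. Cubes have diameter √N δ, and dividing the ball
volume (√N δ)^N |B₁| by the cube volume δ^N leaves an error linear in δ. -/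
theorem exists_totallyBounded_approx (R : ℝ) (M : ℝ≥0) {δ : ℝ} (hδ : 0 < δ) :
    ∃ T : Set (Lp ℝ 1 (volume : Measure (EuclideanSpace ℝ (Fin N)))), TotallyBounded T ∧
      ∀ E (hE : MeasurableSet E) (hEv : volume E ≠ ∞), E ⊆ Metric.closedBall 0 R →
        perimeter E ≤ M → ∃ g ∈ T, dist (indicatorConstLp 1 hE hEv (1 : ℝ)) g ≤
          2 * √N ^ N * volume.real (Metric.closedBall (0 : EuclideanSpace ℝ (Fin N)) 1) * (√N * δ) * M := by
  obtain ⟨Z, hZ⟩ := exists_finset_subset_iUnion_gridCube (N := N) hδ R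
  have hQv : ∀ z : Fin N → ℤ, volume (gridCube δ z) = ENNReal.ofReal (δ ^ N) := fun z => by
    rw [volume_gridCube hδ, ENNReal.ofReal_pow hδ.le]
  have hQr : ∀ z : Fin N → ℤ, volume.real (gridCube δ z) = δ ^ N := fun z => by
    rw [measureReal_def, hQv, ENNReal.toReal_ofReal (by positivity)]
  have hQf : ∀ z : Fin N → ℤ, volume (gridCube δ z) ≠ ∞ := fun z => by simp [hQv]
  have hQ0 : ∀ z : Fin N → ℤ, volume (gridCube δ z) ≠ 0 := fun z => by
    rw [hQv]; simpa using pow_pos hδ N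
  have hQm := measurableSet_gridCube (N := N) δ
  -- Coefficients are indexed by all of ℤ^N, where the product of intervals is compact by Tychonoff;
  -- only those in `Z` enter the sum.
  refine ⟨(fun a : (Fin N → ℤ) → ℝ => ∑ z ∈ Z, a z • indicatorConstLp 1 (hQm z) (hQf z) (1 : ℝ)) ''
    Set.univ.pi fun _ => Set.Icc 0 1, ?_, ?_⟩
  · refine IsCompact.totallyBounded (IsCompact.image (isCompact_univ_pi fun _ => isCompact_Icc) ?_)
    fun_prop
  intro E hE hEv hER hEM
  have hEP : perimeter E ≠ ∞ := (hEM.trans_lt ENNReal.coe_lt_top).ne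
  refine ⟨_, ⟨fun z => volume.real (E ∩ gridCube δ z) / volume.real (gridCube δ z), ?_, rfl⟩, ?_⟩
  · intro z _
    exact ⟨by positivity, div_le_one_of_le₀
      (measureReal_mono Set.inter_subset_right (hQf z)) (by positivity)⟩
  have hEe : E = ⋃ z ∈ Z, E ∩ gridCube δ z := by
    rw [← Set.inter_iUnion₂, Set.inter_eq_left.2 (hER.trans hZ)]
  have hEQf : ∀ z, volume (E ∩ gridCube δ z) ≠ ∞ := fun z =>
    measure_ne_top_of_subset Set.inter_subset_left hEv
  rw [dist_eq_norm, indicatorConstLp_biUnion_finset (fun z => hE.inter (hQm z)) hEQf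
    (fun z w hzw => (disjoint_gridCube δ hzw).mono Set.inter_subset_right Set.inter_subset_right)
    Z hE hEv hEe, ← Finset.sum_sub_distrib]
  refine (norm_sum_le _ _).trans
    ((Finset.sum_le_sum fun z _ => norm_indicatorConstLp_inter_sub_le hE (hQm z) (hQf z) (hQ0 z)).trans ?_)
  simp_rw [hQr]
  rw [← Finset.sum_div, ← Finset.mul_sum, div_le_iff₀ (by positivity)]
  have key := sum_volume_inter_mul_volume_sdiff_le Z hQm (fun z w h => disjoint_gridCube δ h)
    (fun z x hx y hy => norm_sub_le_of_mem_gridCube hδ hx hy) hE hEv hEP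
  have hball : volume (Metric.closedBall (0 : EuclideanSpace ℝ (Fin N)) (√N * δ)) ≠ ∞ :=
    measure_closedBall_lt_top.ne
  have key' := ENNReal.toReal_mono (by finiteness) key
  rw [ENNReal.toReal_sum (fun z _ => ENNReal.mul_ne_top (hEQf z)
    (measure_ne_top_of_subset Set.sdiff_subset (hQf z)))] at key'
  simp only [ENNReal.toReal_mul, ← measureReal_def] at key'
  rw [ENNReal.toReal_ofReal (by positivity), Measure.addHaar_real_closedBall' _ _ (by positivity),
    finrank_euclideanSpace_fin, mul_pow] at key'
  have hPM : (perimeter E).toReal ≤ M := ENNReal.toReal_mono ENNReal.coe_ne_top hEM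
  calc _ ≤ 2 * (√N ^ N * δ ^ N * volume.real (Metric.closedBall (0 : EuclideanSpace ℝ (Fin N)) 1) *
        (√N * δ * (perimeter E).toReal)) := by gcongr
    _ ≤ 2 * (√N ^ N * δ ^ N * volume.real (Metric.closedBall (0 : EuclideanSpace ℝ (Fin N)) 1) *
        (√N * δ * M)) := by gcongr
    _ = _ := by ring

theorem isCompact_closure_indicatorConstLp (R : ℝ) (M : ℝ≥0) :
    IsCompact (closure {f : Lp ℝ 1 (volume : Measure (EuclideanSpace ℝ (Fin N))) |
      ∃ (E : Set (EuclideanSpace ℝ (Fin N))) (hE : MeasurableSet E) (hEv : volume E ≠ ∞),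
        E ⊆ Metric.closedBall 0 R ∧ perimeter E ≤ M ∧ f = indicatorConstLp 1 hE hEv (1 : ℝ)}) := by
  refine TotallyBounded.isCompact_of_isClosed (TotallyBounded.closure ?_) isClosed_closure
  refine totallyBounded_of_forall_exists_dist_lt fun ε hε => ?_
  set C := 2 * √N ^ N * volume.real (Metric.closedBall (0 : EuclideanSpace ℝ (Fin N)) 1) * √N * M with hC
  have hC0 : 0 ≤ C := by positivity
  obtain ⟨T, hT, h⟩ := exists_totallyBounded_approx (N := N) R M (δ := ε / (C + 1)) (by positivity)
  refine ⟨T, hT, ?_⟩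
  rintro _ ⟨E, hE, hEv, hER, hEM, rfl⟩
  obtain ⟨g, hg, hd⟩ := h E hE hEv hER hEM
  refine ⟨g, hg, hd.trans_lt ?_⟩
  calc _ = C * ε / (C + 1) := by rw [hC]; ring
    _ < ε := by rw [div_lt_iff₀ (by positivity)]; nlinarith

/-- The indicator functions of a bounded sequence of `k`-tuples of sets of bounded perimeter
converge in `L¹` along a subsequence. -/
theorem exists_tendsto_indicator_of_perimeter_le {k : ℕ} (R : ℝ) (M : ℝ≥0)
    (Ω : ℕ → Fin k → Set (EuclideanSpace ℝ (Fin N))) (hm : ∀ n i, MeasurableSet (Ω n i))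
    (hR : ∀ n i, Ω n i ⊆ Metric.closedBall 0 R) (hM : ∀ n i, perimeter (Ω n i) ≤ M) :
    ∃ (φ : ℕ → ℕ) (E : Fin k → Set (EuclideanSpace ℝ (Fin N))), StrictMono φ ∧
      (∀ i, MeasurableSet (E i)) ∧
      ∀ i, Tendsto (fun n => eLpNorm (fun x => (Ω (φ n) i).indicator (fun _ => (1 : ℝ)) x -
        (E i).indicator (fun _ => (1 : ℝ)) x) 1 volume) atTop (𝓝 0) := by
  have hv : ∀ n i, volume (Ω n i) ≠ ∞ := fun n i =>
    measure_ne_top_of_subset (hR n i) measure_closedBall_lt_top.ne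
  obtain ⟨f, -, φ, hφ, hf⟩ := (isCompact_univ_pi fun _ : Fin k =>
    isCompact_closure_indicatorConstLp (N := N) R M).tendsto_subseq
    (x := fun n i => indicatorConstLp 1 (hm n i) (hv n i) (1 : ℝ))
    (fun n i _ => subset_closure ⟨_, hm n i, hv n i, hR n i, hM n i, rfl⟩)
  rw [tendsto_pi_nhds] at hf
  have hE : ∀ i, ∃ E : Set (EuclideanSpace ℝ (Fin N)), MeasurableSet E ∧
      f i =ᵐ[volume] E.indicator (fun _ => (1 : ℝ)) := by
    intro i
    -- A subsequence converges almost everywhere, so the limit takes only the values 0 and 1 and is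
    -- the indicator of its level set 1.
    refine ⟨f i ⁻¹' {1}, (Lp.stronglyMeasurable _).measurable (measurableSet_singleton _), ?_⟩
    obtain ⟨ψ, -, hψ⟩ := (tendstoInMeasure_of_tendsto_Lp (hf i)).exists_seq_tendsto_ae
    have hae : ∀ᵐ x, ∀ n, (indicatorConstLp 1 (hm (φ n) i) (hv (φ n) i) (1 : ℝ) :
        EuclideanSpace ℝ (Fin N) → ℝ) x = (Ω (φ n) i).indicator (fun _ => (1 : ℝ)) x :=
      ae_all_iff.2 fun n => indicatorConstLp_coeFn
    filter_upwards [hψ, hae] with x hx hxe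
    have hcl : f i x ∈ ({0, 1} : Set ℝ) := by
      refine (Set.toFinite _).isClosed.mem_of_tendsto hx (Eventually.of_forall fun n => ?_)
      simp only [Function.comp_apply] at hxe ⊢
      rw [hxe]
      by_cases h : x ∈ Ω (φ (ψ n)) i <;> simp [h]
    rcases hcl with h | h
    · simp [Set.indicator, h]
    · have h : f i x = 1 := h
      simp [Set.indicator, h]
  choose E hEm hE using hE
  refine ⟨φ, E, hφ, hEm, fun i => ?_⟩
  have := (Lp.tendsto_Lp_iff_tendsto_eLpNorm' _ _).1 (hf i)
  refine this.congr fun n => eLpNorm_congr_ae ?_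
  filter_upwards [hE i, indicatorConstLp_coeFn (p := 1) (hs := hm (φ n) i) (hμs := hv (φ n) i)
    (c := (1 : ℝ))] with x h1 h2
  simp only [Pi.sub_apply, Function.comp_apply]
  rw [h1, h2]

end Compactness

/-! ### Comparison inequalities and repair of almost-partitions -/

section LimitPartition

theorem eLpNorm_indicator_sub_indicator {X : Type*} [MeasurableSpace X] {μ : Measure X}
    {A B : Set X} (hA : MeasurableSet A) (hB : MeasurableSet B) :
    eLpNorm (fun x => A.indicator (fun _ => (1 : ℝ)) x - B.indicator (fun _ => (1 : ℝ)) x) 1 μ =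
      μ (symmDiff A B) := by
  have h : ∀ x, ‖A.indicator (fun _ => (1 : ℝ)) x - B.indicator (fun _ => (1 : ℝ)) x‖ₑ =
      (symmDiff A B).indicator (fun _ => (1 : ℝ≥0∞)) x := by
    intro x
    by_cases h1 : x ∈ A <;> by_cases h2 : x ∈ B <;> simp [h1, h2, Set.mem_symmDiff]
  simp_rw [eLpNorm_one_eq_lintegral_enorm, h]
  rw [lintegral_indicator_const (hA.symmDiff hB), one_mul]

theorem prod_liminf_le_liminf_prod {ι κ : Type*} {l : Filter ι} (s : Finset κ)
    (u : κ → ι → ℝ≥0∞) :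
    ∏ i ∈ s, liminf (u i) l ≤ liminf (fun n => ∏ i ∈ s, u i n) l := by
  classical
  rcases l.eq_or_neBot with rfl | hl
  · simp
  induction s using Finset.induction_on with
  | empty => simp
  | insert a s ha ih =>
    rw [Finset.prod_insert ha]
    simp_rw [Finset.prod_insert ha]
    exact (mul_le_mul_right ih _).trans ENNReal.le_liminf_mul

/-- An L¹ limit is a partition only up to null sets. The overlaps `t` are removed, and the null
remainder `r` of D is given to the set of index 0, which turns it into an exact partition. -/
theorem exists_isCluster_ae_eq {N k : ℕ} (hk : 0 < k) {D : Set (EuclideanSpace ℝ (Fin N))}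
    (hD : MeasurableSet D) {E : Fin k → Set (EuclideanSpace ℝ (Fin N))} (hED : ∀ i, E i ⊆ D)
    (hEm : ∀ i, MeasurableSet (E i)) (hd : ∀ i j, i ≠ j → volume (E i ∩ E j) = 0)
    (hU : volume (D \ ⋃ i, E i) = 0) :
    ∃ F : Fin k → Set (EuclideanSpace ℝ (Fin N)), IsCluster D F ∧ ⋃ i, F i = D ∧
      ∀ i, F i =ᵐ[volume] E i := by
  obtain ⟨t, htm, ht0, htd⟩ := exists_null_pairwise_disjoint_sdiff (μ := volume) (s := E)
    (fun i j hij => hd i j hij)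
  set r := D \ ⋃ j, (E j \ t j) with hr
  have hr0 : volume r = 0 := by
    have h1 : r ⊆ (D \ ⋃ i, E i) ∪ ⋃ j, t j := by
      intro x hx
      by_cases h : ∃ j, x ∈ t j
      · exact Or.inr (Set.mem_iUnion.2 h)
      · push Not at h
        refine Or.inl ⟨hx.1, fun hx' => hx.2 ?_⟩
        obtain ⟨j, hj⟩ := Set.mem_iUnion.1 hx'
        exact Set.mem_iUnion.2 ⟨j, hj, h j⟩
    exact measure_mono_null h1 (measure_union_null hU (measure_iUnion_null ht0))
  have hrm : MeasurableSet r := hD.diff (MeasurableSet.iUnion fun j => (hEm j).diff (htm j))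
  refine ⟨fun i => (E i \ t i) ∪ {x | x ∈ r ∧ i = ⟨0, hk⟩}, ⟨fun i => ?_, fun i j hij => ?_, fun i => ?_⟩,
    ?_, fun i => ?_⟩
  · rintro x (hx | hx)
    · exact hED i hx.1
    · exact hx.1.1
  · refine Set.disjoint_left.2 ?_
    rintro x (hx | hx) (hx' | hx')
    · exact Set.disjoint_left.1 (htd hij) hx hx'
    · exact hx'.1.2 (Set.mem_iUnion.2 ⟨i, hx⟩)
    · exact hx.1.2 (Set.mem_iUnion.2 ⟨j, hx'⟩)
    · exact hij (hx.2.trans hx'.2.symm)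
  · refine ((hEm i).diff (htm i)).union ?_
    by_cases h : i = ⟨0, hk⟩ <;> simp [h, hrm]
  · refine subset_antisymm (Set.iUnion_subset fun i => ?_) fun x hx => ?_
    · rintro x (hx | hx)
      · exact hED i hx.1
      · exact hx.1.1
    · by_cases h : x ∈ ⋃ j, (E j \ t j)
      · obtain ⟨j, hj⟩ := Set.mem_iUnion.1 h
        exact Set.mem_iUnion.2 ⟨j, Or.inl hj⟩
      · exact Set.mem_iUnion.2 ⟨⟨0, hk⟩, Or.inr ⟨⟨hx, h⟩, rfl⟩⟩
  · have h1 : ({x | x ∈ r ∧ i = ⟨0, hk⟩} : Set _) =ᵐ[volume] (∅ : Set (EuclideanSpace ℝ (Fin N))) :=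
      ae_eq_empty.2 (measure_mono_null (fun x hx => hx.1) hr0)
    have h2 : (E i \ t i : Set _) =ᵐ[volume] E i := sdiff_null_ae_eq_self (ht0 i)
    simpa using h2.union h1

/-- The maximal ratio of the competitor is at most C/m^α. This is finite, which rules out negligible
Ω_i, and clearing the denominator gives the bound. -/
theorem perimeter_le_of_isMaxSolution {N k : ℕ} {D : Set (EuclideanSpace ℝ (Fin N))} {α : ℝ} {Ω F : Fin k → Set (EuclideanSpace ℝ (Fin N))}
    (hΩ : IsMaxSolution α D Ω) (hD : volume D ≠ ∞) (hF : IsCluster D F) {m : ℝ} (hm : 0 < m)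
    (hFv : ∀ i, volume (F i) = ENNReal.ofReal m) {C : ℝ} (hC : 0 ≤ C)
    (hFp : ∀ i, perimeter (F i) ≤ ENNReal.ofReal C) (i : Fin k) :
    0 < volume.real (Ω i) ∧
      perimeter (Ω i) ≤ ENNReal.ofReal (C * (volume.real (Ω i) / m) ^ α) := by
  have h1 : cheegerRatio α (Ω i) ≤ ENNReal.ofReal (C / m ^ α) := by
    refine (le_iSup (fun i => cheegerRatio α (Ω i)) i).trans ((hΩ.2 F hF).trans (iSup_le fun j => ?_))
    have h0 : ENNReal.ofReal m ≠ 0 := by simpa using hm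
    rw [cheegerRatio, hFv j, if_neg h0, ENNReal.ofReal_div_of_pos (by positivity),
      ENNReal.ofReal_rpow_of_pos hm]
    gcongr
    exact hFp j
  have hvf : volume (Ω i) ≠ ∞ := measure_ne_top_of_subset (hΩ.1.1 i) hD
  have hv0 : volume (Ω i) ≠ 0 := by
    intro h0
    rw [cheegerRatio, if_pos h0] at h1
    exact ENNReal.ofReal_ne_top (top_le_iff.1 h1)
  have hpos : 0 < volume.real (Ω i) := ENNReal.toReal_pos hv0 hvf
  refine ⟨hpos, ?_⟩
  rw [cheegerRatio, if_neg hv0, ← ofReal_measureReal hvf, ENNReal.ofReal_rpow_of_pos hpos,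
    ENNReal.div_le_iff (by simpa using Real.rpow_pos_of_pos hpos α) ENNReal.ofReal_ne_top,
    ← ENNReal.ofReal_mul (by positivity)] at h1
  refine h1.trans_eq ?_
  rw [Real.div_rpow hpos.le hm.le]
  ring_nf

/-- Arithmetic-geometric inequality, from y ≤ exp(y - 1) factor by factor. -/
theorem prod_le_one_of_sum_le {ι : Type*} [Fintype ι] {y : ι → ℝ} (hy : ∀ i, 0 ≤ y i)
    (hs : ∑ i, y i ≤ Fintype.card ι) : ∏ i, y i ≤ 1 := by
  calc ∏ i, y i ≤ ∏ i, Real.exp (y i - 1) :=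
        Finset.prod_le_prod (fun i _ => hy i) fun i _ => by linarith [Real.add_one_le_exp (y i - 1)]
    _ = Real.exp (∑ i, y i - Fintype.card ι) := by
        rw [← Real.exp_sum, Finset.sum_sub_distrib]; simp
    _ ≤ 1 := Real.exp_le_one_iff.2 (by linarith)

/-- A single y_i may exceed 1, so y_i^α is uncontrolled for large α; the product of these powers is
(∏ y_i)^α ≤ 1 whatever α is. -/
theorem prod_le_pow_of_le_mul_rpow {ι : Type*} [Fintype ι] {y P : ι → ℝ} {C α : ℝ} (hC : 0 ≤ C)
    (hα : 0 ≤ α) (hy : ∀ i, 0 ≤ y i) (hs : ∑ i, y i ≤ Fintype.card ι) (hP0 : ∀ i, 0 ≤ P i)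
    (hP : ∀ i, P i ≤ C * y i ^ α) : ∏ i, P i ≤ C ^ Fintype.card ι := by
  calc ∏ i, P i ≤ ∏ i, C * y i ^ α := Finset.prod_le_prod (fun i _ => hP0 i) fun i _ => hP i
    _ = C ^ Fintype.card ι * (∏ i, y i) ^ α := by
        rw [Finset.prod_mul_distrib, Real.finsetProd_rpow _ _ fun i _ => hy i]; simp
    _ ≤ C ^ Fintype.card ι := mul_le_of_le_one_right (by positivity)
        (Real.rpow_le_one (Finset.prod_nonneg fun i _ => hy i) (prod_le_one_of_sum_le hy hs) hα)

theorem rpow_inv_le_of_le_rpow {q y α : ℝ} (hq : 0 < q) (hy : 0 < y) (hα : 1 < α)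
    (h : q * y ≤ y ^ α) : q ^ (α - 1)⁻¹ ≤ y := by
  have h1 : q ≤ y ^ (α - 1) := by
    rw [Real.rpow_sub_one hy.ne', le_div_iff₀ hy]; exact h
  have h2 : 0 < α - 1 := by linarith
  calc q ^ (α - 1)⁻¹ ≤ (y ^ (α - 1)) ^ (α - 1)⁻¹ := by gcongr
    _ = y := Real.rpow_rpow_inv hy.le h2.ne'

/-- If all other terms are at least b, the sum constraint leaves at most card - (card - 1) b for the
remaining one, and this tends to 1 with b. -/
theorem tendsto_one_of_sum_le_of_le {ι : Type*} [Fintype ι] {y : ℕ → ι → ℝ} {b : ℕ → ℝ}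
    (hb : Tendsto b atTop (𝓝 1)) (hby : ∀ᶠ n in atTop, ∀ i, b n ≤ y n i)
    (hs : ∀ n, ∑ i, y n i ≤ Fintype.card ι) (i : ι) : Tendsto (fun n => y n i) atTop (𝓝 1) := by
  classical
  have h2 : Tendsto (fun n => (Fintype.card ι : ℝ) - ((Fintype.card ι : ℝ) - 1) * b n) atTop (𝓝 1) := by
    have := (hb.const_mul ((Fintype.card ι : ℝ) - 1)).const_sub (Fintype.card ι : ℝ)
    simpa using this
  refine tendsto_of_tendsto_of_tendsto_of_le_of_le' hb h2 (hby.mono fun n h => h i) ?_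
  filter_upwards [hby] with n hn
  have h3 := hs n
  rw [← Finset.add_sum_erase _ _ (Finset.mem_univ i)] at h3
  have h4 : ∑ j ∈ Finset.univ.erase i, b n ≤ ∑ j ∈ Finset.univ.erase i, y n j :=
    Finset.sum_le_sum fun j _ => hn j
  have hcard : ((Finset.univ.erase i).card : ℝ) = (Fintype.card ι : ℝ) - 1 := by
    rw [Finset.card_erase_of_mem (Finset.mem_univ i), Finset.card_univ,
      Nat.cast_sub (Fintype.card_pos_iff.2 ⟨i⟩), Nat.cast_one]
  rw [Finset.sum_const, nsmul_eq_mul, hcard] at h4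
  linarith

end LimitPartition

/-! ### Asymptotics of solutions and passage to the limit -/

section MainLimit

variable {N k : ℕ}

/-- The two bounds c y ≤ P ≤ C y^α are played against each other: they give y → 1, the product
bound, and then a bound on each factor because the other factors stay away from 0. -/
theorem eventually_perimeter_le (hN : 0 < N) {D : Set (EuclideanSpace ℝ (Fin N))}
    (hDb : Bornology.IsBounded D) {m : ℝ} (hm : 0 < m)
    (hDm : volume D = ENNReal.ofReal (k * m)) {C : ℝ} (hC : 0 < C)
    {F : Fin k → Set (EuclideanSpace ℝ (Fin N))} (hF : IsCluster D F)
    (hFv : ∀ i, volume (F i) = ENNReal.ofReal m) (hFp : ∀ i, perimeter (F i) ≤ ENNReal.ofReal C)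
    {α : ℕ → ℝ} {Ω : ℕ → Fin k → Set (EuclideanSpace ℝ (Fin N))}
    (hα : Tendsto α atTop atTop) (hΩ : ∀ n, IsMaxSolution (α n) D (Ω n)) :
    (∀ i, Tendsto (fun n => volume.real (Ω n i)) atTop (𝓝 m)) ∧
    (∀ᶠ n in atTop, ∏ i, perimeter (Ω n i) ≤ ENNReal.ofReal C ^ k) ∧
    ∃ M : ℝ≥0, ∀ᶠ n in atTop, ∀ i, perimeter (Ω n i) ≤ M := by
  obtain ⟨R, hR0, hR⟩ : ∃ R : ℝ, 0 ≤ R ∧ D ⊆ Metric.closedBall 0 R := by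
    obtain ⟨R, hR⟩ := hDb.subset_closedBall 0
    exact ⟨max R 0, le_max_right _ _, hR.trans (Metric.closedBall_subset_closedBall (le_max_left _ _))⟩
  have hDf : volume D ≠ ∞ := by rw [hDm]; exact ENNReal.ofReal_ne_top
  have hcl : ∀ n, IsCluster D (Ω n) := fun n => (hΩ n).1
  set y : ℕ → Fin k → ℝ := fun n i => volume.real (Ω n i) / m with hy
  set P : ℕ → Fin k → ℝ := fun n i => (perimeter (Ω n i)).toReal with hPdef
  have hsol := fun n i => perimeter_le_of_isMaxSolution (hΩ n) hDf hF hm hFv hC.le hFp i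
  have hy0 : ∀ n i, 0 < y n i := fun n i => div_pos (hsol n i).1 hm
  have hPtop : ∀ n i, perimeter (Ω n i) ≠ ∞ := fun n i =>
    ((hsol n i).2.trans_lt ENNReal.ofReal_lt_top).ne
  have hP0 : ∀ n i, 0 ≤ P n i := fun n i => ENNReal.toReal_nonneg
  have hP : ∀ n i, P n i ≤ C * y n i ^ α n := fun n i => by
    refine ENNReal.toReal_le_of_le_ofReal ?_ (hsol n i).2
    have := hy0 n i
    positivity
  have hsum : ∀ n, ∑ i, y n i ≤ Fintype.card (Fin k) := by
    intro n
    rw [Fintype.card_fin, hy, ← Finset.sum_div, div_le_iff₀ hm]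
    have h1 : ∑ i, volume (Ω n i) ≤ volume D := by
      have hu := measure_iUnion (μ := volume) (fun i j hij => (hcl n).2.1 i j hij) (hcl n).2.2
      rw [tsum_fintype] at hu
      rw [← hu]
      exact measure_mono (Set.iUnion_subset (hcl n).1)
    rw [hDm] at h1
    have h2 := ENNReal.toReal_mono ENNReal.ofReal_ne_top h1
    rw [ENNReal.toReal_sum fun i _ => measure_ne_top_of_subset ((hcl n).1 i) hDf,
      ENNReal.toReal_ofReal (by positivity)] at h2
    exact h2
  -- The constant of `volume_le_mul_perimeter`, rescaled by m.
  set c : ℝ := m / (2 * R + 1) with hc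
  have hc0 : 0 < c := by positivity
  have hlow : ∀ n i, c * y n i ≤ P n i := by
    intro n i
    have h1 := volume_le_mul_perimeter ((hcl n).2.2 i) (hPtop n i) hN hR0 (((hcl n).1 i).trans hR)
    have h2 := ENNReal.toReal_mono (by have := hPtop n i; finiteness) h1
    rw [ENNReal.toReal_mul, ENNReal.toReal_ofReal (by positivity)] at h2
    rw [hc, hy]
    have : m / (2 * R + 1) * (volume.real (Ω n i) / m) = volume.real (Ω n i) / (2 * R + 1) := by
      field_simp
    simp only [this]
    rw [div_le_iff₀ (by positivity), mul_comm]
    exact h2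
  have hprod : ∀ᶠ n in atTop, ∏ i, P n i ≤ C ^ k := by
    filter_upwards [hα.eventually_ge_atTop 0] with n hn
    simpa using prod_le_pow_of_le_mul_rpow hC.le hn (fun i => (hy0 n i).le) (hsum n) (hP0 n) (hP n)
  have hylim : ∀ i, Tendsto (fun n => y n i) atTop (𝓝 1) := by
    refine tendsto_one_of_sum_le_of_le (b := fun n => (c / C) ^ (α n - 1)⁻¹) ?_ ?_ hsum
    · have h1 : Tendsto (fun n => (α n - 1)⁻¹) atTop (𝓝 0) :=
        tendsto_inv_atTop_zero.comp (tendsto_atTop_add_const_right _ (-1) hα)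
      have h2 := (Real.continuous_const_rpow (a := c / C) (by positivity)).tendsto 0
      rw [Real.rpow_zero] at h2
      exact h2.comp h1
    · filter_upwards [hα.eventually_gt_atTop 1] with n hn i
      refine rpow_inv_le_of_le_rpow (by positivity) (hy0 n i) hn ?_
      rw [div_mul_eq_mul_div, div_le_iff₀ hC, mul_comm _ C]
      exact (hlow n i).trans (hP n i)
  refine ⟨fun i => ?_, ?_, ?_⟩
  · have := (hylim i).mul_const m
    simp only [hy, one_mul, div_mul_cancel₀ _ hm.ne'] at this
    exact this
  · filter_upwards [hprod] with n hn
    have : ∏ i, perimeter (Ω n i) = ENNReal.ofReal (∏ i, P n i) := by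
      rw [ENNReal.ofReal_prod_of_nonneg fun i _ => hP0 n i]
      exact Finset.prod_congr rfl fun i _ => (ENNReal.ofReal_toReal (hPtop n i)).symm
    rw [this, ← ENNReal.ofReal_pow hC.le]
    exact ENNReal.ofReal_le_ofReal hn
  · refine ⟨(C ^ k / (c / 2) ^ (k - 1)).toNNReal, ?_⟩
    have hhalf : ∀ᶠ n in atTop, ∀ i, 1 / 2 < y n i :=
      eventually_all.2 fun i => (hylim i).eventually_const_lt (by norm_num)
    filter_upwards [hprod, hhalf] with n hn hh i
    have h1 : ∀ j, c / 2 ≤ P n j := fun j => by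
      nlinarith [hlow n j, hh j]
    have h2 : (c / 2) ^ (k - 1) ≤ ∏ j ∈ Finset.univ.erase i, P n j := by
      have := Finset.prod_le_prod (s := Finset.univ.erase i) (fun j _ => (half_pos hc0).le)
        (fun j _ => h1 j)
      rwa [Finset.prod_const, Finset.card_erase_of_mem (Finset.mem_univ i), Finset.card_univ,
        Fintype.card_fin] at this
    rw [← Finset.mul_prod_erase _ _ (Finset.mem_univ i)] at hn
    change perimeter (Ω n i) ≤ ENNReal.ofReal _
    refine (ENNReal.le_ofReal_iff_toReal_le (hPtop n i) (by positivity)).2 ?_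
    rw [le_div_iff₀ (by positivity)]
    exact (mul_le_mul_of_nonneg_left h2 (hP0 n i)).trans hn

/-- Along a subsequence the solutions converge to an equal partition, whose product of perimeters
is controlled by the perimeter of any equal-measure competitor. -/
theorem exists_tendstoL1_isEqualPartition (hN : 0 < N) (hk : 0 < k)
    {D : Set (EuclideanSpace ℝ (Fin N))} (hD : MeasurableSet D)
    (hDb : Bornology.IsBounded D) (hD0 : volume D ≠ 0) {C : ℝ}
    {F : Fin k → Set (EuclideanSpace ℝ (Fin N))} (hF : IsCluster D F)
    (hFv : ∀ i, volume (F i) = volume D / k) (hFp : ∀ i, perimeter (F i) ≤ ENNReal.ofReal C)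
    {α : ℕ → ℝ} {Ω : ℕ → Fin k → Set (EuclideanSpace ℝ (Fin N))}
    (hα : Tendsto α atTop atTop) (hΩ : ∀ n, IsMaxSolution (α n) D (Ω n)) :
    ∃ (φ : ℕ → ℕ) (E : Fin k → Set (EuclideanSpace ℝ (Fin N))),
      StrictMono φ ∧ TendstoL1 D (fun n => Ω (φ n)) E ∧ IsEqualPartition D E ∧
      ∏ i, perimeter (E i) ≤ ENNReal.ofReal C ^ k := by
  have hDf : volume D ≠ ∞ := hDb.measure_lt_top.ne
  have hk' : (0 : ℝ) < k := by exact_mod_cast hk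
  set m : ℝ := volume.real D / k with hmdef
  have hm : 0 < m := div_pos (ENNReal.toReal_pos hD0 hDf) hk'
  have hDm : volume D = ENNReal.ofReal (k * m) := by
    rw [hmdef, mul_div_cancel₀ _ hk'.ne', ofReal_measureReal hDf]
  have hDk : volume D / k = ENNReal.ofReal m := by
    rw [hmdef, ENNReal.ofReal_div_of_pos hk', ofReal_measureReal hDf, ENNReal.ofReal_natCast]
  rw [hDk] at hFv
  obtain ⟨R, hR0, hR⟩ : ∃ R : ℝ, 0 ≤ R ∧ D ⊆ Metric.closedBall 0 R := by
    obtain ⟨R, hR⟩ := hDb.subset_closedBall 0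
    exact ⟨max R 0, le_max_right _ _, hR.trans (Metric.closedBall_subset_closedBall (le_max_left _ _))⟩
  -- A set of zero perimeter in a ball has zero volume, whereas the competitor has volume m > 0.
  have hC : 0 < C := by
    by_contra hC
    have h0 : perimeter (F ⟨0, hk⟩) = 0 := by
      have := hFp ⟨0, hk⟩
      rwa [ENNReal.ofReal_of_nonpos (not_lt.1 hC), nonpos_iff_eq_zero] at this
    have := volume_le_mul_perimeter (hF.2.2 ⟨0, hk⟩) (by simp [h0]) hN hR0 ((hF.1 _).trans hR)
    rw [h0, mul_zero, hFv] at this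
    simp at this
    linarith
  obtain ⟨hvol, hprod, M, hM⟩ := eventually_perimeter_le hN hDb hm hDm hC hF hFv hFp hα hΩ
  obtain ⟨n₀, hn₀⟩ := eventually_atTop.1 (hprod.and hM)
  have hcl : ∀ n, IsCluster D (Ω n) := fun n => (hΩ n).1
  obtain ⟨ψ, E₀, hψ, hE₀m, hE₀⟩ := exists_tendsto_indicator_of_perimeter_le R M
    (fun n => Ω (n + n₀)) (fun n i => (hcl _).2.2 i) (fun n i => ((hcl _).1 i).trans hR)
    (fun n i => (hn₀ _ (Nat.le_add_left _ _)).2 i)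
  have hφ : StrictMono fun n => ψ n + n₀ := fun a b hab => by
    simpa using hψ hab
  set φ : ℕ → ℕ := fun n => ψ n + n₀ with hφdef
  have hφge : ∀ n, n₀ ≤ φ n := fun n => Nat.le_add_left _ _
  -- The limit sets lie in D only up to null sets, hence the intersection with D.
  have hE₁m : ∀ i, MeasurableSet (E₀ i ∩ D) := fun i => (hE₀m i).inter hD
  have hsymm : ∀ i, Tendsto (fun n => volume (symmDiff (Ω (φ n) i) (E₀ i ∩ D))) atTop (𝓝 0) := by
    intro i
    have := hE₀ i
    simp_rw [eLpNorm_indicator_sub_indicator ((hcl _).2.2 i) (hE₀m i)] at this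
    refine tendsto_of_tendsto_of_tendsto_of_le_of_le tendsto_const_nhds this (fun _ => zero_le)
      fun n => measure_mono fun x hx => ?_
    have : x ∈ Ω (ψ n + n₀) i → x ∈ D := fun h => (hcl _).1 i h
    simp only [Set.mem_symmDiff, Set.mem_inter_iff, hφdef] at hx ⊢
    tauto
  have hE₁f : ∀ i, volume (E₀ i ∩ D) ≠ ∞ := fun i => measure_ne_top_of_subset Set.inter_subset_right hDf
  have hvolE : ∀ i, volume (E₀ i ∩ D) = ENNReal.ofReal m := by
    intro i
    have h1 : Tendsto (fun n => volume (Ω (φ n) i)) atTop (𝓝 (ENNReal.ofReal m)) := by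
      have := ENNReal.tendsto_ofReal ((hvol i).comp hφ.tendsto_atTop)
      refine this.congr fun n => ?_
      exact ofReal_measureReal (measure_ne_top_of_subset ((hcl _).1 i) hDf)
    apply le_antisymm
    · have h2 := h1.add (hsymm i)
      rw [add_zero] at h2
      refine ge_of_tendsto' h2 fun n => (measure_mono fun x hx => ?_).trans (measure_union_le _ _)
      by_cases hx' : x ∈ Ω (φ n) i
      · exact Or.inl hx'
      · exact Or.inr (Or.inr ⟨hx, hx'⟩)
    · have h2 := (tendsto_const_nhds (x := volume (E₀ i ∩ D))).add (hsymm i)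
      rw [add_zero] at h2
      refine le_of_tendsto_of_tendsto' h1 h2 fun n => (measure_mono fun x hx => ?_).trans (measure_union_le _ _)
      by_cases hx' : x ∈ E₀ i ∩ D
      · exact Or.inl hx'
      · exact Or.inr (Or.inl ⟨hx, hx'⟩)
  have hdisj : ∀ i j, i ≠ j → volume ((E₀ i ∩ D) ∩ (E₀ j ∩ D)) = 0 := by
    intro i j hij
    have h2 := (hsymm i).add (hsymm j)
    rw [add_zero] at h2
    refine le_antisymm (ge_of_tendsto' h2 fun n => (measure_mono fun x hx => ?_).trans
      (measure_union_le _ _)) zero_le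
    by_cases hx' : x ∈ Ω (φ n) i
    · exact Or.inr (Or.inr ⟨hx.2, Set.disjoint_left.1 ((hcl _).2.1 i j hij) hx'⟩)
    · exact Or.inl (Or.inr ⟨hx.1, hx'⟩)
  -- Essentially disjoint sets of volume m: k of them exhaust |D| = km.
  have hUm : volume (⋃ i, E₀ i ∩ D) = volume D := by
    rw [measure_iUnion₀ (fun i j hij => hdisj i j hij) fun i => (hE₁m i).nullMeasurableSet,
      tsum_fintype]
    simp_rw [hvolE]
    rw [Finset.sum_const, Finset.card_univ, Fintype.card_fin, hDm, ENNReal.ofReal_mul hk'.le,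
      nsmul_eq_mul, ENNReal.ofReal_natCast]
  have hUsub : (⋃ i, E₀ i ∩ D) ⊆ D := Set.iUnion_subset fun i => Set.inter_subset_right
  have hU : volume (D \ ⋃ i, E₀ i ∩ D) = 0 := by
    rw [measure_sdiff hUsub (MeasurableSet.iUnion hE₁m).nullMeasurableSet (by rw [hUm]; exact hDf),
      hUm, tsub_self]
  obtain ⟨E, hE, hEU, hEae⟩ := exists_isCluster_ae_eq hk hD (fun i => Set.inter_subset_right) hE₁m
    hdisj hU
  have hL1 : ∀ i, Tendsto (fun n => eLpNorm (fun x => (Ω (φ n) i).indicator (fun _ => (1 : ℝ)) x -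
      (E i).indicator (fun _ => (1 : ℝ)) x) 1 volume) atTop (𝓝 0) := by
    intro i
    simp_rw [eLpNorm_indicator_sub_indicator ((hcl _).2.2 i) (hE.2.2 i)]
    refine (hsymm i).congr fun n => measure_congr ?_
    exact (ae_eq_refl _).symmDiff (hEae i).symm
  refine ⟨φ, E, hφ, fun i => ?_, ⟨hE, hEU, fun i => ?_⟩, ?_⟩
  · exact tendsto_of_tendsto_of_tendsto_of_le_of_le tendsto_const_nhds (hL1 i) (fun _ => zero_le)
      fun n => eLpNorm_mono_measure _ Measure.restrict_le_self
  · rw [measure_congr (hEae i), hvolE, hDk]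
  · calc ∏ i, perimeter (E i) ≤ ∏ i, liminf (fun n => perimeter (Ω (φ n) i)) atTop := by
          refine Finset.prod_le_prod' fun i _ => perimeter_le_liminf fun ψ hψ hc => ?_
          exact tendsto_setIntegral_of_eLpNorm_indicator_sub (hE.2.2 i) (fun n => (hcl _).2.2 i)
            (hL1 i) hψ hc
      _ ≤ liminf (fun n => ∏ i, perimeter (Ω (φ n) i)) atTop :=
          prod_liminf_le_liminf_prod Finset.univ fun i n => perimeter (Ω (φ n) i)
      _ ≤ ENNReal.ofReal C ^ k :=
          liminf_le_of_le (by isBoundedDefault) fun b hb => by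
            obtain ⟨n, hn⟩ := hb.exists
            exact hn.trans (hn₀ _ (hφge n)).1

end MainLimit

/-! ### Perimeter bounded by inner Minkowski content -/

section MinkowskiContent

variable {N : ℕ}

theorem fderiv_eq_zero_of_mem_Icc_of_notMem_Ioo {X : Type*} [NormedAddCommGroup X] [NormedSpace ℝ X]
    {f : X → ℝ} {a b : ℝ} (hf : ∀ x, f x ∈ Set.Icc a b) {x : X} (hx : f x ∉ Set.Ioo a b) :
    fderiv ℝ f x = 0 := by
  rcases (hf x).1.eq_or_lt with h | h
  · have : IsLocalMin f x := Eventually.of_forall fun y => h ▸ (hf y).1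
    exact this.fderiv_eq_zero
  · have h2 : f x = b := le_antisymm (hf x).2 (not_lt.1 fun h' => hx ⟨h, h'⟩)
    have : IsLocalMax f x := Eventually.of_forall fun y => h2 ▸ (hf y).2
    exact this.fderiv_eq_zero

/-- Integrate by parts: |∇f| ≤ L almost everywhere by Rademacher, and ∇f vanishes where f is 0 or 1,
since such points are extrema. -/
theorem integral_mul_divergence_le {f : EuclideanSpace ℝ (Fin N) → ℝ} {L : ℝ≥0}
    (hf : LipschitzWith L f) (h01 : ∀ x, f x ∈ Set.Icc (0 : ℝ) 1)
    (hv : volume (f ⁻¹' Set.Ioo 0 1) ≠ ∞)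
    {φ : EuclideanSpace ℝ (Fin N) → EuclideanSpace ℝ (Fin N)} (hφ : ContDiff ℝ 1 φ)
    (hc : HasCompactSupport φ) (hb : ∀ x, ‖φ x‖ ≤ 1) :
    ∫ x, f x * divergence φ x ≤ L * volume.real (f ⁻¹' Set.Ioo 0 1) := by
  have hφi : ∀ i, ContDiff ℝ 1 fun x => φ x i := fun i => by fun_prop
  have hci : ∀ i, HasCompactSupport fun x => φ x i := fun i =>
    hc.comp_left (g := fun v : EuclideanSpace ℝ (Fin N) => v i) rfl
  have hφd : Differentiable ℝ φ := hφ.differentiable one_ne_zero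
  have hline : ∀ i x, lineDeriv ℝ (fun y => φ y i) x (-EuclideanSpace.single i 1) =
      -(fderiv ℝ φ x (EuclideanSpace.single i 1)) i := by
    intro i x
    have h1 : HasFDerivAt (fun y => φ y i)
        ((EuclideanSpace.proj i : EuclideanSpace ℝ (Fin N) →L[ℝ] ℝ).comp (fderiv ℝ φ x)) x :=
      (EuclideanSpace.proj i : EuclideanSpace ℝ (Fin N) →L[ℝ] ℝ).hasFDerivAt.comp x
        (hφd x).hasFDerivAt
    rw [(h1.hasLineDerivAt _).lineDeriv]
    simp
  have hint1 : ∀ i, Integrable fun x => (fderiv ℝ φ x (EuclideanSpace.single i 1)) i * f x := by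
    intro i
    have hcont : Continuous fun x => (fderiv ℝ φ x (EuclideanSpace.single i 1)) i := by
      have h2 : Continuous fun x => fderiv ℝ φ x (EuclideanSpace.single i 1) :=
        (hφ.continuous_fderiv one_ne_zero).clm_apply continuous_const
      fun_prop
    refine (hcont.mul hf.continuous).integrable_of_hasCompactSupport ?_
    refine HasCompactSupport.mul_right ((hc.fderiv ℝ).mono fun x hx => ?_)
    contrapose! hx
    have hx' : fderiv ℝ φ x = 0 := by simpa using hx
    simp [hx']
  have hint2 : ∀ i, Integrable fun x => lineDeriv ℝ f x (EuclideanSpace.single i 1) * φ x i := by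
    intro i
    have := (hf.locallyIntegrable_lineDeriv (μ := volume)
      (EuclideanSpace.single i (1:ℝ))).integrable_smul_left_of_hasCompactSupport
      (hφi i).continuous (hci i)
    refine this.congr (Eventually.of_forall fun x => ?_)
    simp [mul_comm]
  have hparts : ∫ x, f x * divergence φ x =
      - ∫ x, ∑ i, lineDeriv ℝ f x (EuclideanSpace.single i 1) * φ x i := by
    have h1 : ∀ x, f x * divergence φ x = ∑ i, (fderiv ℝ φ x (EuclideanSpace.single i 1)) i * f x := by
      intro x
      rw [divergence, ← Finset.sum_mul, mul_comm]
    simp_rw [h1]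
    rw [integral_finsetSum _ fun i _ => hint1 i, integral_finsetSum _ fun i _ => hint2 i,
      ← Finset.sum_neg_distrib]
    refine Finset.sum_congr rfl fun i _ => ?_
    obtain ⟨K, hK⟩ := (hφi i).lipschitzWith_of_hasCompactSupport (hci i) one_ne_zero
    rw [hf.integral_lineDeriv_mul_eq hK (hci i), ← integral_neg]
    refine integral_congr_ae (Eventually.of_forall fun x => ?_)
    simp only [hline]
    ring
  have hSm : MeasurableSet (f ⁻¹' Set.Ioo 0 1) := hf.continuous.measurable measurableSet_Ioo
  rw [hparts]
  refine (neg_le_abs _).trans ?_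
  rw [← Real.norm_eq_abs]
  have hI : ∫ x, (f ⁻¹' Set.Ioo 0 1).indicator (fun _ => (L : ℝ)) x =
      L * volume.real (f ⁻¹' Set.Ioo 0 1) := by
    rw [integral_indicator_const _ hSm, smul_eq_mul, mul_comm]
  rw [← hI]
  refine norm_integral_le_of_norm_le ((integrable_indicator_iff hSm).2 (integrableOn_const hv)) ?_
  filter_upwards [hf.ae_differentiableAt (μ := volume)] with x hx
  have h1 : ∑ i, lineDeriv ℝ f x (EuclideanSpace.single i 1) * φ x i = fderiv ℝ f x (φ x) := by
    conv_rhs => rw [← (EuclideanSpace.basisFun (Fin N) ℝ).sum_repr (φ x)]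
    rw [map_sum]
    refine Finset.sum_congr rfl fun i _ => ?_
    rw [hx.lineDeriv_eq_fderiv]
    simp [mul_comm]
  rw [h1]
  by_cases hxS : x ∈ f ⁻¹' Set.Ioo 0 1
  · rw [Set.indicator_of_mem hxS]
    calc ‖fderiv ℝ f x (φ x)‖ ≤ ‖fderiv ℝ f x‖ * ‖φ x‖ := ContinuousLinearMap.le_opNorm _ _
      _ ≤ L * 1 := by
        gcongr
        · exact norm_fderiv_le_of_lipschitz ℝ hf
        · exact hb x
      _ = L := mul_one _
  · rw [Set.indicator_of_notMem hxS, fderiv_eq_zero_of_mem_Icc_of_notMem_Ioo h01 hxS]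
    simp

/-- The perimeter of an open set is at most its inner Minkowski content. -/
theorem perimeter_le_of_volume_infDist_lt {A : Set (EuclideanSpace ℝ (Fin N))} (hA : IsOpen A)
    (hAne : Aᶜ.Nonempty) {ε c : ℕ → ℝ} (hε0 : ∀ n, 0 < ε n) (hε : Tendsto ε atTop (𝓝 0)) {C : ℝ}
    (hc0 : ∀ n, 0 ≤ c n) (hc : Tendsto c atTop (𝓝 C))
    (hv : ∀ n, volume {x | x ∈ A ∧ Metric.infDist x Aᶜ < ε n} ≤ ENNReal.ofReal (c n * ε n)) :
    perimeter A ≤ ENNReal.ofReal C := by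
  refine iSup₂_le fun φ ⟨hφ, hφc, hφb⟩ => ENNReal.ofReal_le_ofReal ?_
  -- Cut-offs of slope 1/ε whose transition lies in the inner collar of width ε. The collar has
  -- volume at most cε, so the integral against div φ is at most c, and the cut-offs converge to the
  -- indicator of A.
  set f : ℕ → EuclideanSpace ℝ (Fin N) → ℝ := fun n x => min 1 (Metric.infDist x Aᶜ / ε n) with hf
  have hfL : ∀ n, LipschitzWith (ε n)⁻¹.toNNReal (f n) := by
    intro n
    have h1 : LipschitzWith (ε n)⁻¹.toNNReal fun x => Metric.infDist x Aᶜ / ε n := by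
      refine LipschitzWith.of_dist_le_mul fun x y => ?_
      have h2 := (Metric.lipschitz_infDist_pt Aᶜ).dist_le_mul x y
      rw [Real.coe_toNNReal _ (inv_pos.2 (hε0 n)).le, Real.dist_eq, ← sub_div, abs_div,
        abs_of_pos (hε0 n), div_eq_inv_mul]
      have := inv_pos.2 (hε0 n)
      gcongr
      simpa [Real.dist_eq] using h2
    exact h1.const_min 1
  have hf01 : ∀ n x, f n x ∈ Set.Icc (0:ℝ) 1 := fun n x =>
    ⟨le_min zero_le_one (div_nonneg Metric.infDist_nonneg (hε0 n).le), min_le_left _ _⟩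
  have hsub : ∀ n, f n ⁻¹' Set.Ioo 0 1 ⊆ {x | x ∈ A ∧ Metric.infDist x Aᶜ < ε n} := by
    intro n x hx
    refine ⟨?_, ?_⟩
    · by_contra hxA
      have := hx.1
      simp [hf, Metric.infDist_zero_of_mem (s := Aᶜ) hxA] at this
    · have := hx.2
      simp only [hf, min_lt_iff, lt_irrefl, false_or] at this
      rwa [div_lt_one (hε0 n)] at this
  have hfv : ∀ n, volume (f n ⁻¹' Set.Ioo 0 1) ≤ ENNReal.ofReal (c n * ε n) := fun n =>
    (measure_mono (hsub n)).trans (hv n)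
  have hle : ∀ n, ∫ x, f n x * divergence φ x ≤ c n := by
    intro n
    refine (integral_mul_divergence_le (hfL n) (hf01 n)
      ((hfv n).trans_lt ENNReal.ofReal_lt_top).ne hφ hφc hφb).trans ?_
    rw [Real.coe_toNNReal _ (inv_pos.2 (hε0 n)).le, inv_mul_le_iff₀ (hε0 n), mul_comm]
    exact ENNReal.toReal_le_of_le_ofReal (mul_nonneg (hc0 n) (hε0 n).le) (hfv n)
  have hdi := integrable_divergence hφ hφc
  have hlim : Tendsto (fun n => ∫ x, f n x * divergence φ x) atTop (𝓝 (∫ x in A, divergence φ x)) := by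
    rw [← integral_indicator hA.measurableSet]
    refine tendsto_integral_of_dominated_convergence (fun x => ‖divergence φ x‖)
      (fun n => ((hfL n).continuous.mul (continuous_divergence hφ)).aestronglyMeasurable) hdi.norm
      (fun n => Eventually.of_forall fun x => ?_) (Eventually.of_forall fun x => ?_)
    · rw [norm_mul, Real.norm_of_nonneg (hf01 n x).1]
      exact mul_le_of_le_one_left (norm_nonneg _) (hf01 n x).2
    · by_cases hx : x ∈ A
      · rw [Set.indicator_of_mem hx]
        have hpos : 0 < Metric.infDist x Aᶜ :=
          (hA.isClosed_compl.notMem_iff_infDist_pos hAne).1 (by simpa using hx)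
        refine tendsto_const_nhds.congr' ?_
        filter_upwards [hε.eventually_lt_const hpos] with n hn
        have : 1 ≤ Metric.infDist x Aᶜ / ε n := (one_le_div (hε0 n)).2 hn.le
        simp [hf, this]
      · rw [Set.indicator_of_notMem hx]
        have : Metric.infDist x Aᶜ = 0 := Metric.infDist_zero_of_mem hx
        simp [hf, this]
  exact le_of_tendsto_of_tendsto' hlim hc hle

end MinkowskiContent

/-! ### Equal-volume competitors in a Lipschitz domain -/

section LipschitzDomain

variable {N : ℕ}

/-- F grows at unit rate along ν, so the translates of the slab by jδν are disjoint. About 1/δ of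
them fit in the ball of radius R + 1. -/
theorem volume_slab_le {F : EuclideanSpace ℝ (Fin N) → ℝ} (hF : Continuous F)
    {ν : EuclideanSpace ℝ (Fin N)} (hν : ‖ν‖ = 1) (hFν : ∀ y s, F (y + s • ν) = F y + s)
    (R a : ℝ) {δ : ℝ} (hδ : 0 < δ) :
    volume {y | y ∈ Metric.closedBall (0 : EuclideanSpace ℝ (Fin N)) R ∧ a ≤ F y ∧ F y < a + δ} ≤
      ENNReal.ofReal (volume.real (Metric.closedBall (0 : EuclideanSpace ℝ (Fin N)) (R + 1)) * δ) := by
  set V := volume.real (Metric.closedBall (0 : EuclideanSpace ℝ (Fin N)) (R + 1)) with hV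
  set S := {y | y ∈ Metric.closedBall (0 : EuclideanSpace ℝ (Fin N)) R ∧ a ≤ F y ∧ F y < a + δ} with hS
  have hSm : MeasurableSet S := measurableSet_closedBall.inter
    ((measurableSet_le measurable_const hF.measurable).inter
      (measurableSet_lt hF.measurable measurable_const))
  set m := ⌈1 / δ⌉₊ with hm
  have hm1 : 1 / δ ≤ m := Nat.le_ceil _
  have hm2 : (m : ℝ) < 1 / δ + 1 := Nat.ceil_lt_add_one (by positivity)
  have hmpos : (0 : ℝ) < m := lt_of_lt_of_le (by positivity) hm1
  set T : ℕ → Set (EuclideanSpace ℝ (Fin N)) := fun j => (fun y => y + (-(j * δ)) • ν) ⁻¹' S with hT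
  have hTF : ∀ j : ℕ, ∀ y ∈ T j, a + j * δ ≤ F y ∧ F y < a + (j + 1) * δ := by
    intro j y hy
    have h1 := hy.2
    rw [hFν] at h1
    constructor <;> linarith
  have hTd : ∀ i j : ℕ, i < j → Disjoint (T i) (T j) := by
    intro i j hij
    refine Set.disjoint_left.2 fun y hi hj => ?_
    have h1 := (hTF i y hi).2
    have h2 := (hTF j y hj).1
    have h3 : ((i : ℝ) + 1) ≤ j := by exact_mod_cast hij
    nlinarith
  have hTv : ∀ j, volume (T j) = volume S := fun j => measure_preimage_add_right _ _ _
  have hTm : ∀ j, MeasurableSet (T j) := fun j => hSm.preimage (by fun_prop)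
  have hsum : (m : ℝ≥0∞) * volume S ≤ volume (Metric.closedBall (0 : EuclideanSpace ℝ (Fin N)) (R + 1)) := by
    have h1 : volume (⋃ j ∈ Finset.range m, T j) = ∑ j ∈ Finset.range m, volume (T j) := by
      refine measure_biUnion_finset (fun i _ j _ hij => ?_) fun j _ => hTm j
      rcases lt_or_gt_of_ne hij with h | h
      · exact hTd i j h
      · exact (hTd j i h).symm
    simp only [hTv, Finset.sum_const, Finset.card_range, nsmul_eq_mul] at h1
    rw [← h1]
    refine measure_mono (Set.iUnion₂_subset fun j hj y hy => ?_)
    have hjm : (j : ℝ) + 1 ≤ m := by exact_mod_cast Finset.mem_range.1 hj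
    have h2 : (j : ℝ) * δ ≤ 1 := by
      have : (j : ℝ) < 1 / δ := by linarith
      exact ((lt_div_iff₀ hδ).1 this).le
    have h3 := mem_closedBall_zero_iff.1 hy.1
    rw [mem_closedBall_zero_iff]
    have h4 : ‖((j : ℝ) * δ) • ν‖ = j * δ := by
      rw [norm_smul, hν, mul_one, Real.norm_of_nonneg (by positivity)]
    calc ‖y‖ = ‖(y + (-(j * δ)) • ν) + ((j : ℝ) * δ) • ν‖ := by congr 1; module
      _ ≤ ‖y + (-(j * δ)) • ν‖ + ‖((j : ℝ) * δ) • ν‖ := norm_add_le _ _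
      _ ≤ R + 1 := by rw [h4]; linarith
  have hSf : volume S ≠ ∞ :=
    measure_ne_top_of_subset (fun y hy => hy.1) (measure_closedBall_lt_top (x := 0) (r := R)).ne
  have h5 := ENNReal.toReal_mono measure_closedBall_lt_top.ne hsum
  rw [ENNReal.toReal_mul, ENNReal.toReal_natCast] at h5
  refine (ENNReal.le_ofReal_iff_toReal_le hSf (by positivity)).2 ?_
  have h6 : (volume S).toReal * (m * δ) ≤ V * δ := by
    have := mul_le_mul_of_nonneg_right h5 hδ.le
    rw [hV, measureReal_def]
    linarith
  have h7 : 1 ≤ m * δ := (div_le_iff₀ hδ).1 hm1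
  nlinarith [ENNReal.toReal_nonneg (a := volume S)]

/-- Near x, D is {F > 0}, where F is the height above the graph. F is Lipschitz and F ≤ 0 at
boundary points, so points of D within ε of them lie in a slab 0 ≤ F < Lε. -/
theorem HasLipschitzBoundary.exists_nhds_volume_le {D : Set (EuclideanSpace ℝ (Fin N))}
    (hD : IsOpen D) (hDb : Bornology.IsBounded D) (hL : HasLipschitzBoundary D)
    {x : EuclideanSpace ℝ (Fin N)} (hx : x ∈ frontier D) :
    ∃ t ∈ 𝓝[frontier D] x, ∃ ρ > 0, ∃ C : ℝ, 0 ≤ C ∧ ∀ ε, 0 < ε → ε < ρ →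
      volume {y | y ∈ D ∧ ∃ w ∈ t, dist y w < ε} ≤ ENNReal.ofReal (C * ε) := by
  obtain ⟨ν, hν, K, g, hg, U, hU, hUD⟩ := hL x hx
  obtain ⟨R, hR⟩ := hDb.subset_closedBall 0
  obtain ⟨r, hr, hrU⟩ := Metric.mem_nhds_iff.1 hU
  have hνν : ⟪ν, ν⟫_ℝ = 1 := by rw [real_inner_self_eq_norm_sq, hν]; norm_num
  set F : EuclideanSpace ℝ (Fin N) → ℝ := fun y => ⟪ν, y⟫_ℝ - g (y - ⟪ν, y⟫_ℝ • ν) with hFdef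
  have hFc : Continuous F := by
    have := hg.continuous
    fun_prop
  have hFν : ∀ y s, F (y + s • ν) = F y + s := by
    intro y s
    simp only [hFdef, inner_add_right, inner_smul_right, hνν, mul_one]
    rw [show y + s • ν - (⟪ν, y⟫_ℝ + s) • ν = y - ⟪ν, y⟫_ℝ • ν by module]
    ring
  -- The height contributes 1; the projection along ν is crudely 2-Lipschitz, which gives 2K.
  set L : ℝ := 1 + 2 * K with hLdef
  have hL1 : 0 < L := by positivity
  have hFL : ∀ y w, F y ≤ F w + L * dist y w := by
    intro y w
    have h1 : ⟪ν, y⟫_ℝ - ⟪ν, w⟫_ℝ ≤ dist y w := by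
      rw [← inner_sub_right, dist_eq_norm]
      simpa [hν] using real_inner_le_norm ν (y - w)
    have h1' : |⟪ν, y - w⟫_ℝ| ≤ dist y w := by
      rw [dist_eq_norm]
      simpa [hν] using abs_real_inner_le_norm ν (y - w)
    have h2 := hg.dist_le_mul (y - ⟪ν, y⟫_ℝ • ν) (w - ⟪ν, w⟫_ℝ • ν)
    have h3 : dist (y - ⟪ν, y⟫_ℝ • ν) (w - ⟪ν, w⟫_ℝ • ν) ≤ 2 * dist y w := by
      rw [dist_eq_norm, show y - ⟪ν, y⟫_ℝ • ν - (w - ⟪ν, w⟫_ℝ • ν) = (y - w) - ⟪ν, y - w⟫_ℝ • ν by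
        rw [inner_sub_right]; module]
      refine (norm_sub_le _ _).trans ?_
      rw [norm_smul, hν, mul_one, Real.norm_eq_abs, two_mul, ← dist_eq_norm]
      gcongr
    have h4 : g (w - ⟪ν, w⟫_ℝ • ν) - g (y - ⟪ν, y⟫_ℝ • ν) ≤ K * (2 * dist y w) := by
      rw [Real.dist_eq] at h2
      have := neg_abs_le (g (y - ⟪ν, y⟫_ℝ • ν) - g (w - ⟪ν, w⟫_ℝ • ν))
      have h5 := mul_le_mul_of_nonneg_left h3 K.coe_nonneg
      linarith
    simp only [hFdef, hLdef]
    linarith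
  refine ⟨frontier D ∩ Metric.ball x (r / 2),
    inter_mem_nhdsWithin _ (Metric.ball_mem_nhds x (half_pos hr)), r / 2, half_pos hr,
    volume.real (Metric.closedBall (0 : EuclideanSpace ℝ (Fin N)) (R + 1)) * L, by positivity,
    fun ε hε hερ => ?_⟩
  have hε1 : ε < r / 2 := hερ
  rw [mul_assoc]
  refine (measure_mono ?_).trans (volume_slab_le hFc hν hFν R 0 (by positivity))
  rintro y ⟨hyD, w, ⟨hwf, hwb⟩, hyw⟩
  have hwD : w ∉ D := fun h => by
    rw [hD.frontier_eq] at hwf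
    exact hwf.2 h
  have hwU : w ∈ U := hrU (Metric.ball_subset_ball (by linarith) hwb)
  have hyU : y ∈ U := hrU (by
    rw [Metric.mem_ball] at hwb ⊢
    linarith [dist_triangle y w x])
  have h1 := (hUD y hyU).1 hyD
  have h2 : ¬ (g (w - ⟪ν, w⟫_ℝ • ν) < ⟪ν, w⟫_ℝ) := fun h => hwD ((hUD w hwU).2 h)
  have h3 := hFL y w
  have h4 : L * dist y w < L * ε := by gcongr
  refine ⟨hR hyD, ?_, ?_⟩ <;> simp only [hFdef] at h3 ⊢ <;> linarith

/-- A bounded Lipschitz domain has finite inner Minkowski content. -/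
theorem HasLipschitzBoundary.exists_volume_infDist_lt_le {D : Set (EuclideanSpace ℝ (Fin N))}
    (hD : IsOpen D) (hDb : Bornology.IsBounded D) (hL : HasLipschitzBoundary D) :
    ∃ ρ > 0, ∃ C : ℝ, 0 ≤ C ∧ ∀ ε, 0 < ε → ε < ρ →
      volume {y | y ∈ D ∧ ∃ w ∉ D, dist y w < ε} ≤ ENNReal.ofReal (C * ε) := by
  have hcomp : IsCompact (frontier D) :=
    Metric.isCompact_of_isClosed_isBounded isClosed_frontier
      (hDb.closure.subset frontier_subset_closure)
  have main := hcomp.induction_on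
    (p := fun t => ∃ ρ > 0, ∃ C : ℝ, 0 ≤ C ∧ ∀ ε, 0 < ε → ε < ρ →
      volume {y | y ∈ D ∧ ∃ w ∈ t, dist y w < ε} ≤ ENNReal.ofReal (C * ε))
    ⟨1, one_pos, 0, le_rfl, by simp⟩ ?_ ?_ fun x hx => hL.exists_nhds_volume_le hD hDb hx
  · obtain ⟨ρ, hρ, C, hC, h⟩ := main
    refine ⟨ρ, hρ, C, hC, fun ε hε hερ => (measure_mono ?_).trans (h ε hε hερ)⟩
    rintro y ⟨hyD, w, hw, hyw⟩
    -- An outside point closer than ε is replaced by a nearest boundary point.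
    obtain ⟨z, hz, hyz⟩ := exists_mem_frontier_infDist_compl_eq_dist hyD
      (fun h => hw (h ▸ Set.mem_univ w))
    refine ⟨hyD, z, hz, ?_⟩
    rw [← hyz]
    exact (Metric.infDist_le_dist_of_mem (s := Dᶜ) hw).trans_lt hyw
  · rintro s t hst ⟨ρ, hρ, C, hC, h⟩
    refine ⟨ρ, hρ, C, hC, fun ε hε hερ => (measure_mono ?_).trans (h ε hε hερ)⟩
    rintro y ⟨hyD, w, hw, hyw⟩
    exact ⟨hyD, w, hst hw, hyw⟩
  · rintro s t ⟨ρ, hρ, C, hC, h⟩ ⟨ρ', hρ', C', hC', h'⟩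
    refine ⟨min ρ ρ', lt_min hρ hρ', C + C', add_nonneg hC hC', fun ε hε hερ => ?_⟩
    rw [add_mul, ENNReal.ofReal_add (by positivity) (by positivity)]
    refine le_trans ?_ (add_le_add (h ε hε (hερ.trans_le (min_le_left _ _)))
      (h' ε hε (hερ.trans_le (min_le_right _ _))))
    refine (measure_mono ?_).trans (measure_union_le _ _)
    rintro y ⟨hyD, w, hw | hw, hyw⟩
    · exact Or.inl ⟨hyD, w, hw, hyw⟩
    · exact Or.inr ⟨hyD, w, hw, hyw⟩

theorem volume_coord_slab_le {D : Set (EuclideanSpace ℝ (Fin N))} {R : ℝ}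
    (hR : D ⊆ Metric.closedBall 0 R) (i : Fin N) (a : ℝ) {δ : ℝ} (hδ : 0 < δ) :
    volume {y | y ∈ D ∧ a ≤ y i ∧ y i < a + δ} ≤
      ENNReal.ofReal (volume.real (Metric.closedBall (0 : EuclideanSpace ℝ (Fin N)) (R + 1)) * δ) := by
  refine (measure_mono fun y hy => ?_).trans (volume_slab_le (F := fun y => y i) (by fun_prop)
    (ν := EuclideanSpace.single i 1) (by simp) (by simp) R a hδ)
  exact ⟨hR hy.1, hy.2⟩

/-- The volume below height t is Lipschitz in t by the slab bound; apply the intermediate value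
theorem. -/
theorem exists_volume_cut_eq {D : Set (EuclideanSpace ℝ (Fin N))} {R : ℝ}
    (hR : D ⊆ Metric.closedBall 0 R) (i : Fin N) {s : ℝ} (hs : s ∈ Set.Icc 0 (volume.real D)) :
    ∃ t, volume.real {y | y ∈ D ∧ y i < t} = s := by
  have hDf : volume D ≠ ∞ := measure_ne_top_of_subset hR measure_closedBall_lt_top.ne
  have hf : ∀ p : EuclideanSpace ℝ (Fin N) → Prop, volume {y | y ∈ D ∧ p y} ≠ ∞ := fun p =>
    measure_ne_top_of_subset (fun y hy => hy.1) hDf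
  set V := volume.real (Metric.closedBall (0 : EuclideanSpace ℝ (Fin N)) (R + 1)) with hV
  set v : ℝ → ℝ := fun t => volume.real {y | y ∈ D ∧ y i < t} with hv
  have hmono : Monotone v := fun a b hab =>
    measureReal_mono (fun y hy => ⟨hy.1, hy.2.trans_le hab⟩) (hf _)
  have hstep : ∀ a b, a < b → v b - v a ≤ V * (b - a) := by
    intro a b hab
    have h1 := ENNReal.toReal_mono ENNReal.ofReal_ne_top
      (volume_coord_slab_le hR i a (sub_pos.2 hab))
    rw [ENNReal.toReal_ofReal (mul_nonneg measureReal_nonneg (by linarith)), add_sub_cancel] at h1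
    have h2 : v b ≤ v a + volume.real {y | y ∈ D ∧ a ≤ y i ∧ y i < b} := by
      refine (measureReal_mono ?_ (measure_union_ne_top (hf _) (hf _))).trans (measureReal_union_le _ _)
      rintro y ⟨hyD, hy⟩
      rcases lt_or_ge (y i) a with h | h
      · exact Or.inl ⟨hyD, h⟩
      · exact Or.inr ⟨hyD, h, hy⟩
    rw [measureReal_def] at h2
    linarith
  have hcont : Continuous v := by
    rw [Metric.continuous_iff]
    intro b ε hε
    have hV0 : 0 ≤ V := measureReal_nonneg
    refine ⟨ε / (V + 1), by positivity, fun a ha => ?_⟩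
    have h2 : |a - b| < ε / (V + 1) := ha
    rw [lt_div_iff₀ (by positivity)] at h2
    rw [Real.dist_eq, abs_lt]
    rcases lt_trichotomy a b with h | h | h
    · have h3 := hstep a b h
      have h4 := hmono h.le
      rw [abs_of_neg (by linarith)] at h2
      constructor <;> nlinarith
    · subst h; simp [hε]
    · have h3 := hstep b a h
      have h4 := hmono h.le
      rw [abs_of_pos (by linarith)] at h2
      constructor <;> nlinarith
  have hcoord : ∀ y ∈ D, |y i| ≤ R := fun y hy =>
    (PiLp.norm_apply_le y i).trans (mem_closedBall_zero_iff.1 (hR hy))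
  have h0 : v (-R) = 0 := by
    have : {y | y ∈ D ∧ y i < -R} = ∅ := by
      refine Set.eq_empty_of_forall_notMem fun y hy => ?_
      have := (abs_le.1 (hcoord y hy.1)).1
      linarith [hy.2]
    simp [hv, this]
  have h1 : v (R + 1) = volume.real D := by
    have : {y | y ∈ D ∧ y i < R + 1} = D := by
      refine Set.ext fun y => ⟨fun hy => hy.1, fun hy => ⟨hy, ?_⟩⟩
      have := (abs_le.1 (hcoord y hy)).2
      linarith
    simp [hv, this]
  rcases lt_or_ge R 0 with hRneg | hRpos
  · have : D = ∅ := Set.subset_empty_iff.1 (hR.trans (Metric.closedBall_eq_empty.2 hRneg).subset)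
    subst this
    simp at hs
    exact ⟨0, by simp [hs]⟩
  · obtain ⟨t, -, ht⟩ := intermediate_value_Icc (by linarith : -R ≤ R + 1) hcont.continuousOn
      (by rw [h0, h1]; exact hs)
    exact ⟨t, ht⟩

/-- Slice D by hyperplanes orthogonal to one axis, at heights where the volume below is (j/k)|D|.
Taking the slices open discards only null sets and makes the Minkowski bound applicable. -/
theorem exists_isCluster_equal_volume_perimeter_le (hN : 0 < N) {k : ℕ} (hk : 0 < k)
    {D : Set (EuclideanSpace ℝ (Fin N))} (hD : IsOpen D) (hDb : Bornology.IsBounded D)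
    (hD0 : volume D ≠ 0) (hL : HasLipschitzBoundary D) :
    ∃ (F : Fin k → Set (EuclideanSpace ℝ (Fin N))) (C : ℝ), IsCluster D F ∧
      (∀ i, volume (F i) = volume D / k) ∧ ∀ i, perimeter (F i) ≤ ENNReal.ofReal C := by
  obtain ⟨R, hR⟩ := hDb.subset_closedBall 0
  have hDf : volume D ≠ ∞ := hDb.measure_lt_top.ne
  have hDpos : 0 < volume.real D := ENNReal.toReal_pos hD0 hDf
  have hk' : (0 : ℝ) < k := by exact_mod_cast hk
  obtain ⟨ρ, hρ, C, hC, hmink⟩ := hL.exists_volume_infDist_lt_le hD hDb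
  set V := volume.real (Metric.closedBall (0 : EuclideanSpace ℝ (Fin N)) (R + 1)) with hV
  have hV0 : 0 ≤ V := measureReal_nonneg
  let i₀ : Fin N := ⟨0, hN⟩
  have hf : ∀ p : EuclideanSpace ℝ (Fin N) → Prop, volume {y | y ∈ D ∧ p y} ≠ ∞ := fun p =>
    measure_ne_top_of_subset (fun y hy => hy.1) hDf
  have hex : ∀ j : ℕ, ∃ t, j ≤ k → volume.real {y | y ∈ D ∧ y i₀ < t} = j / k * volume.real D := by
    intro j
    by_cases hj : j ≤ k
    · have hj' : (j : ℝ) ≤ k := by exact_mod_cast hj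
      obtain ⟨t, ht⟩ := exists_volume_cut_eq hR i₀
        (s := j / k * volume.real D)
        ⟨by positivity, mul_le_of_le_one_left hDpos.le ((div_le_one hk').2 hj')⟩
      exact ⟨t, fun _ => ht⟩
    · exact ⟨0, fun h => absurd h hj⟩
  choose t ht using hex
  have htmono : ∀ i j, i < j → j ≤ k → t i < t j := by
    intro i j hij hj
    by_contra hle
    have h1 : volume.real {y | y ∈ D ∧ y i₀ < t j} ≤ volume.real {y | y ∈ D ∧ y i₀ < t i} :=
      measureReal_mono (fun y hy => ⟨hy.1, hy.2.trans_le (not_lt.1 hle)⟩) (hf _)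
    rw [ht j hj, ht i (hij.le.trans hj)] at h1
    have h2 : (i : ℝ) < j := by exact_mod_cast hij
    have h3 : (i : ℝ) / k * volume.real D < j / k * volume.real D := by gcongr
    linarith
  have hco : Continuous fun y : EuclideanSpace ℝ (Fin N) => y i₀ := by fun_prop
  set F : Fin k → Set (EuclideanSpace ℝ (Fin N)) :=
    fun j => {y | y ∈ D ∧ t j < y i₀ ∧ y i₀ < t (j + 1)} with hF
  have hFo : ∀ j, IsOpen (F j) := fun j =>
    hD.inter ((isOpen_lt continuous_const hco).inter (isOpen_lt hco continuous_const))
  have hnull : ∀ a, volume {y | y ∈ D ∧ y i₀ = a} = 0 := by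
    intro a
    have h1 : Tendsto (fun n : ℕ => ENNReal.ofReal (V * (1 / ((n : ℝ) + 1)))) atTop (𝓝 0) := by
      have := ENNReal.tendsto_ofReal ((tendsto_one_div_add_atTop_nhds_zero_nat (𝕜 := ℝ)).const_mul V)
      simpa using this
    refine le_antisymm (ge_of_tendsto' h1 fun n => ?_) zero_le
    refine (measure_mono fun y hy => ?_).trans (volume_coord_slab_le hR i₀ a
      (δ := 1 / ((n : ℝ) + 1)) (by positivity))
    have : (0 : ℝ) < 1 / ((n : ℝ) + 1) := by positivity
    refine ⟨hy.1, hy.2.ge, ?_⟩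
    rw [hy.2]
    linarith
  -- A point of a slice near its complement is near the outside of D (constant C) or near one of the
  -- two cutting hyperplanes (constant V each).
  refine ⟨F, C + 2 * V, ⟨fun j y hy => hy.1, fun i j hij => ?_, fun j => (hFo j).measurableSet⟩,
    fun j => ?_, fun j => ?_⟩
  · have key : ∀ i j : Fin k, i < j → Disjoint (F i) (F j) := by
      intro i j hij
      refine Set.disjoint_left.2 fun y hi hj => ?_
      have h1 : t (i + 1) ≤ t j := by
        rcases (Nat.succ_le_of_lt hij).eq_or_lt with h | h
        · exact le_of_eq (congrArg t h)
        · exact (htmono _ _ h j.2.le).le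
      linarith [hi.2.2, hj.2.1]
    rcases lt_or_gt_of_ne hij with h | h
    · exact key i j h
    · exact (key j i h).symm
  · have h1 : {y | y ∈ D ∧ y i₀ < t (j + 1)} =
        {y | y ∈ D ∧ y i₀ < t j} ∪ ({y | y ∈ D ∧ y i₀ = t j} ∪ F j) := by
      ext y
      have := htmono j (j + 1) (Nat.lt_succ_self _) j.2
      simp only [hF, Set.mem_union, Set.mem_ofPred_eq]
      constructor
      · rintro ⟨h1, h2⟩
        rcases lt_trichotomy (y i₀) (t j) with h | h | h <;> tauto
      · rintro (⟨h1, h2⟩ | ⟨h1, h2⟩ | ⟨h1, h2, h3⟩)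
        · exact ⟨h1, h2.trans this⟩
        · exact ⟨h1, h2 ▸ this⟩
        · exact ⟨h1, h3⟩
    have h2 : volume ({y | y ∈ D ∧ y i₀ = t j} ∪ F j) = volume (F j) := by
      refine le_antisymm ((measure_union_le _ _).trans ?_) (measure_mono Set.subset_union_right)
      rw [hnull, zero_add]
    have hEm : MeasurableSet ({y | y ∈ D ∧ y i₀ = t j} ∪ F j) :=
      (hD.measurableSet.inter (measurableSet_eq_fun hco.measurable measurable_const)).union
        (hFo j).measurableSet
    have h3 : volume.real {y | y ∈ D ∧ y i₀ < t (j + 1)} =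
        volume.real {y | y ∈ D ∧ y i₀ < t j} + volume.real ({y | y ∈ D ∧ y i₀ = t j} ∪ F j) := by
      rw [h1, measureReal_union _ hEm (hf _) (measure_union_ne_top (hf _) (hf _))]
      · refine Set.disjoint_left.2 ?_
        rintro y ⟨-, hy⟩ (⟨-, hy'⟩ | ⟨-, hy', -⟩) <;> linarith
    rw [ht _ j.2, ht _ j.2.le, measureReal_def _ (_ ∪ _), h2] at h3
    have h4 : (volume (F j)).toReal = volume.real D / k := by
      push_cast at h3
      field_simp at h3 ⊢
      linarith
    rw [← ENNReal.ofReal_toReal (hf _ : volume (F j) ≠ ∞), h4, ENNReal.ofReal_div_of_pos hk',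
      ofReal_measureReal hDf, ENNReal.ofReal_natCast]
  · have hFne : (F j)ᶜ.Nonempty := by
      rw [Set.nonempty_compl]
      intro h
      have h1 : EuclideanSpace.single i₀ (t j) ∈ F j := h ▸ Set.mem_univ _
      have := h1.2.1
      simp at this
    refine perimeter_le_of_volume_infDist_lt (hFo j) hFne
      (ε := fun n => ρ * (1 / 2) ^ (n + 1)) (c := fun _ => C + 2 * V) (fun n => by positivity) ?_
      (fun _ => by positivity) tendsto_const_nhds fun n => ?_
    · have h1 : Tendsto (fun n : ℕ => ((1 : ℝ) / 2) ^ (n + 1)) atTop (𝓝 0) :=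
        (tendsto_add_atTop_iff_nat 1).2 (tendsto_pow_atTop_nhds_zero_of_lt_one (by norm_num) (by norm_num))
      simpa using h1.const_mul (ρ)
    · have hlt : ρ * ((1 : ℝ) / 2) ^ (n + 1) < ρ :=
        mul_lt_of_lt_one_right hρ (pow_lt_one₀ (by norm_num) (by norm_num) (by simp))
      have hpos : 0 < ρ * ((1 : ℝ) / 2) ^ (n + 1) := by positivity
      generalize ρ * ((1 : ℝ) / 2) ^ (n + 1) = ε at hlt hpos
      have e1 := hmink ε hpos hlt
      have e2 := volume_coord_slab_le hR i₀ (t j) hpos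
      have e3 := volume_coord_slab_le hR i₀ (t (j + 1) - ε) hpos
      rw [show (C + 2 * V) * ε = C * ε + (V * ε + V * ε) by ring,
        ENNReal.ofReal_add (by positivity) (by positivity),
        ENNReal.ofReal_add (by positivity) (by positivity)]
      refine le_trans ?_ (add_le_add e1 (add_le_add e2 e3))
      refine (measure_mono ?_).trans ((measure_union_le _ _).trans
        (add_le_add le_rfl (measure_union_le _ _)))
      rintro y ⟨hy, hyd⟩
      obtain ⟨z, hz, hyz⟩ := (Metric.infDist_lt_iff hFne).1 hyd
      by_cases hzD : z ∈ D
      · have hc : |y i₀ - z i₀| < ε := by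
          refine lt_of_le_of_lt ?_ hyz
          rw [dist_eq_norm]
          exact PiLp.norm_apply_le (y - z) i₀
        rw [abs_lt] at hc
        have hz' : ¬ (t j < z i₀ ∧ z i₀ < t (j + 1)) := fun h => hz ⟨hzD, h⟩
        rcases lt_or_ge (t j) (z i₀) with h | h
        · have h' : t (j + 1) ≤ z i₀ := not_lt.1 fun h'' => hz' ⟨h, h''⟩
          exact Or.inr (Or.inr ⟨hy.1, by linarith, by linarith [hy.2.2]⟩)
        · exact Or.inr (Or.inl ⟨hy.1, hy.2.1.le, by linarith⟩)
      · exact Or.inl ⟨hy.1, z, hzD, hyz⟩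

end LipschitzDomain

/-! ### Area, perimeter and tiling by regular hexagons -/

section Hexagons

theorem hexApothem_pos : 0 < hexApothem := by
  unfold hexApothem
  positivity

theorem hexApothem_sq : 2 * √3 * hexApothem ^ 2 = 1 := by
  unfold hexApothem
  rw [Real.sq_sqrt (by positivity)]
  field_simp

theorem inner_hexDir_hexDir (θ θ' : ℝ) (i j : ℕ) :
    ⟪hexDir θ i, hexDir θ' j⟫_ℝ = Real.cos ((θ - θ') + ((i : ℝ) - j) * (Real.pi / 3)) := by
  rw [show (θ - θ') + ((i : ℝ) - j) * (Real.pi / 3) =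
    (θ + i * (Real.pi / 3)) - (θ' + j * (Real.pi / 3)) by ring, Real.cos_sub]
  simp [hexDir, PiLp.inner_apply, Fin.sum_univ_two]
  ring

theorem norm_hexDir (θ : ℝ) (j : ℕ) : ‖hexDir θ j‖ = 1 := by
  have h := real_inner_self_eq_norm_sq (hexDir θ j)
  rw [inner_hexDir_hexDir] at h
  simp only [sub_self, zero_mul, add_zero, Real.cos_zero] at h
  exact (pow_eq_one_iff_of_nonneg (norm_nonneg _) two_ne_zero).1 h.symm

theorem hexDir_add_three (θ : ℝ) (j : ℕ) : hexDir θ (j + 3) = -hexDir θ j := by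
  have h : θ + ((j : ℝ) + 3) * (Real.pi / 3) = (θ + j * (Real.pi / 3)) + Real.pi := by
    ring
  ext i
  fin_cases i <;> simp [hexDir, h, Real.cos_add_pi, Real.sin_add_pi]

theorem hexDir_two (θ : ℝ) : hexDir θ 2 = hexDir θ 1 - hexDir θ 0 := by
  have h : θ + 2 * (Real.pi / 3) = (θ + Real.pi / 3) + Real.pi / 3 := by
    ring
  have h3 : √3 * √3 = 3 := Real.mul_self_sqrt (by norm_num)
  ext i
  fin_cases i
  · simp [hexDir, h, Real.cos_add, Real.sin_add]
    linear_combination (-Real.cos θ / 4) * h3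
  · simp [hexDir, h, Real.cos_add, Real.sin_add]
    linear_combination (-Real.sin θ / 4) * h3

/-- The open regular hexagon of apothem `s`. -/
def openHexagon (θ s : ℝ) (c : EuclideanSpace ℝ (Fin 2)) : Set (EuclideanSpace ℝ (Fin 2)) :=
  {x | ∀ j : Fin 6, ⟪hexDir θ j, x - c⟫_ℝ < s}

theorem isOpen_openHexagon (θ s : ℝ) (c : EuclideanSpace ℝ (Fin 2)) :
    IsOpen (openHexagon θ s c) := by
  have : openHexagon θ s c = ⋂ j : Fin 6, {x | ⟪hexDir θ j, x - c⟫_ℝ < s} := by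
    ext; simp [openHexagon]
  rw [this]
  exact isOpen_iInter_of_finite fun j => isOpen_lt (by fun_prop) continuous_const

theorem openHexagon_subset_hexagon (θ : ℝ) (c : EuclideanSpace ℝ (Fin 2)) :
    openHexagon θ hexApothem c ⊆ hexagon θ c := fun _ hx j => (hx j).le

/-- The six normals are ±e₀, ±e₁ and ±(e₁ - e₀), so in the coordinates u = ⟨e₀, x - c⟩, v = ⟨e₁, x -
c⟩ the hexagon is given by three absolute values. -/
theorem mem_openHexagon_iff (θ s : ℝ) (c x : EuclideanSpace ℝ (Fin 2)) :
    x ∈ openHexagon θ s c ↔ |⟪hexDir θ 0, x - c⟫_ℝ| < s ∧ |⟪hexDir θ 1, x - c⟫_ℝ| < s ∧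
      |⟪hexDir θ 1, x - c⟫_ℝ - ⟪hexDir θ 0, x - c⟫_ℝ| < s := by
  have h3 := hexDir_add_three θ 0
  have h4 := hexDir_add_three θ 1
  have h5 := hexDir_add_three θ 2
  norm_num at h3 h4 h5
  simp only [openHexagon, Set.mem_ofPred_eq, Fin.forall_fin_succ, abs_lt]
  simp [h3, h4, h5, hexDir_two, inner_sub_left]
  constructor
  · rintro ⟨a, b, c, d, e, f⟩
    refine ⟨⟨?_, ?_⟩, ⟨?_, ?_⟩, ?_, ?_⟩ <;> linarith
  · rintro ⟨⟨a, b⟩, ⟨c, d⟩, e, f⟩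
    refine ⟨?_, ?_, ?_, ?_, ?_, ?_⟩ <;> linarith

theorem volume_hexagonal_region {s : ℝ} (hs : 0 < s) :
    volume {p : ℝ × ℝ | |p.1| < s ∧ |p.2| < s ∧ |p.2 - p.1| < s} = ENNReal.ofReal (3 * s ^ 2) := by
  have h1 : {p : ℝ × ℝ | |p.1| < s ∧ |p.2| < s ∧ |p.2 - p.1| < s} =
      regionBetween (fun u => max (-s) (u - s)) (fun u => min s (u + s)) (Set.Ioo (-s) s) := by
    ext ⟨u, v⟩
    simp only [regionBetween, Set.mem_ofPred_eq, Set.mem_Ioo, abs_lt, max_lt_iff, lt_min_iff]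
    constructor
    · rintro ⟨⟨a, b⟩, ⟨c, d⟩, e, f⟩
      refine ⟨⟨?_, ?_⟩, ⟨?_, ?_⟩, ?_, ?_⟩ <;> linarith
    · rintro ⟨⟨a, b⟩, ⟨c, d⟩, e, f⟩
      refine ⟨⟨?_, ?_⟩, ⟨?_, ?_⟩, ?_, ?_⟩ <;> linarith
  have hc1 : Continuous fun u : ℝ => max (-s) (u - s) := by fun_prop
  have hc2 : Continuous fun u : ℝ => min s (u + s) := by fun_prop
  have hi : ∀ {f : ℝ → ℝ}, Continuous f → IntegrableOn f (Set.Ioo (-s) s) := fun hf =>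
    (hf.integrableOn_Icc (a := -s) (b := s)).mono_set Set.Ioo_subset_Icc_self
  rw [h1, Measure.volume_eq_prod, volume_regionBetween_eq_integral (hi hc1) (hi hc2) measurableSet_Ioo]
  · congr 1
    rw [← integral_Ioc_eq_integral_Ioo, ← intervalIntegral.integral_of_le (by linarith)]
    have hii : ∀ a b, IntervalIntegrable ((fun u : ℝ => min s (u + s)) - fun u => max (-s) (u - s)) volume a b :=
      fun a b => (hc2.sub hc1).intervalIntegrable a b
    rw [← intervalIntegral.integral_add_adjacent_intervals (hii (-s) 0) (hii 0 s)]
    have e1 : ∫ u in (-s)..0, ((fun u : ℝ => min s (u + s)) - fun u => max (-s) (u - s)) u =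
        ∫ u in (-s)..0, (2 * s + u) := by
      refine intervalIntegral.integral_congr fun u hu => ?_
      rw [Set.uIcc_of_le (by linarith)] at hu
      simp only [Pi.sub_apply]
      rw [min_eq_right (by linarith [hu.2]), max_eq_left (by linarith [hu.2])]
      ring
    have e2 : ∫ u in (0:ℝ)..s, ((fun u : ℝ => min s (u + s)) - fun u => max (-s) (u - s)) u =
        ∫ u in (0:ℝ)..s, (2 * s - u) := by
      refine intervalIntegral.integral_congr fun u hu => ?_
      rw [Set.uIcc_of_le hs.le] at hu
      simp only [Pi.sub_apply]
      rw [min_eq_left (by linarith [hu.1]), max_eq_right (by linarith [hu.1])]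
      ring
    rw [e1, e2, intervalIntegral.integral_add (by simp) (by simp),
      intervalIntegral.integral_sub (by simp) (by simp)]
    simp
    ring
  · intro u hu
    simp only [max_le_iff, le_min_iff]
    refine ⟨⟨?_, ?_⟩, ?_, ?_⟩ <;> linarith [hu.1, hu.2]

/-- In the coordinates (u, v) the area is 3s², and the change of variables has determinant sin(π/3)
= √3/2. -/
theorem volume_openHexagon {s : ℝ} (hs : 0 < s) (θ : ℝ) (c : EuclideanSpace ℝ (Fin 2)) :
    volume (openHexagon θ s c) = ENNReal.ofReal (2 * √3 * s ^ 2) := by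
  set A : Matrix (Fin 2) (Fin 2) ℝ :=
    !![Real.cos θ, Real.sin θ; Real.cos (θ + Real.pi / 3), Real.sin (θ + Real.pi / 3)] with hA
  have hdet : LinearMap.det (Matrix.toLin' A) = √3 / 2 := by
    rw [LinearMap.det_toLin', hA, Matrix.det_fin_two_of, Real.cos_add, Real.sin_add,
      Real.cos_pi_div_three, Real.sin_pi_div_three]
    linear_combination (√3 / 2) * Real.sin_sq_add_cos_sq θ
  have h3 : 0 < √3 := by positivity
  have hSm : MeasurableSet {p : ℝ × ℝ | |p.1| < s ∧ |p.2| < s ∧ |p.2 - p.1| < s} := by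
    refine IsOpen.measurableSet ?_
    exact (isOpen_lt continuous_fst.abs continuous_const).inter
      ((isOpen_lt continuous_snd.abs continuous_const).inter
        (isOpen_lt (continuous_snd.sub continuous_fst).abs continuous_const))
  have h1 : openHexagon θ s c = (fun x => x + -c) ⁻¹' (WithLp.ofLp ⁻¹' (Matrix.toLin' A ⁻¹'
      (MeasurableEquiv.finTwoArrow ⁻¹'
        {p : ℝ × ℝ | |p.1| < s ∧ |p.2| < s ∧ |p.2 - p.1| < s}))) := by
    ext x
    rw [mem_openHexagon_iff]
    have e0 : ⟪hexDir θ 0, x - c⟫_ℝ = (Matrix.toLin' A (x + -c).ofLp) 0 := by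
      simp [hexDir, PiLp.inner_apply, Fin.sum_univ_two, hA, Matrix.mulVec, dotProduct]
      ring
    have e1 : ⟪hexDir θ 1, x - c⟫_ℝ = (Matrix.toLin' A (x + -c).ofLp) 1 := by
      simp [hexDir, PiLp.inner_apply, Fin.sum_univ_two, hA, Matrix.mulVec, dotProduct]
      ring
    rw [e0, e1]
    rfl
  have hm1 : MeasurableSet (MeasurableEquiv.finTwoArrow ⁻¹'
        {p : ℝ × ℝ | |p.1| < s ∧ |p.2| < s ∧ |p.2 - p.1| < s}) :=
    hSm.preimage MeasurableEquiv.finTwoArrow.measurable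
  have hm2 : MeasurableSet (Matrix.toLin' A ⁻¹' (MeasurableEquiv.finTwoArrow ⁻¹'
        {p : ℝ × ℝ | |p.1| < s ∧ |p.2| < s ∧ |p.2 - p.1| < s})) :=
    hm1.preimage (LinearMap.continuous_of_finiteDimensional _).measurable
  rw [h1, measure_preimage_add_right,
    (PiLp.volume_preserving_ofLp (Fin 2)).measure_preimage hm2.nullMeasurableSet,
    Measure.addHaar_preimage_linearMap _ (by rw [hdet]; positivity),
    (volume_preserving_finTwoArrow ℝ).measure_preimage hSm.nullMeasurableSet,
    volume_hexagonal_region hs, hdet, ← ENNReal.ofReal_mul (by positivity),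
    abs_of_pos (by positivity)]
  congr 1
  have h4 : √3 * √3 = 3 := Real.mul_self_sqrt (by norm_num)
  field_simp
  nlinarith

theorem volume_openHexagon_hexApothem (θ : ℝ) (c : EuclideanSpace ℝ (Fin 2)) :
    volume (openHexagon θ hexApothem c) = 1 := by
  rw [volume_openHexagon hexApothem_pos, hexApothem_sq, ENNReal.ofReal_one]

theorem volume_hexagon_le (θ : ℝ) (c : EuclideanSpace ℝ (Fin 2)) : volume (hexagon θ c) ≤ 1 := by
  have h : Tendsto (fun n : ℕ => ENNReal.ofReal (2 * √3 * (hexApothem + 1 / ((n : ℝ) + 1)) ^ 2))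
      atTop (𝓝 1) := by
    have h1 : (1 : ℝ≥0∞) = ENNReal.ofReal (2 * √3 * hexApothem ^ 2) := by
      rw [hexApothem_sq, ENNReal.ofReal_one]
    rw [h1]
    refine ENNReal.tendsto_ofReal (Tendsto.const_mul _ (Tendsto.pow ?_ 2))
    simpa using (tendsto_one_div_add_atTop_nhds_zero_nat (𝕜 := ℝ)).const_add hexApothem
  refine ge_of_tendsto' h fun n => ?_
  have hpos : (0 : ℝ) < 1 / ((n : ℝ) + 1) := by positivity
  rw [← volume_openHexagon (add_pos hexApothem_pos hpos) θ c]
  exact measure_mono fun x hx j => (hx j).trans_lt (by linarith)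

/-- The collar of width ε lies between the hexagons of apothems r and r - ε, with area 2√3(r² - (r -
ε)²) ≤ 4√3 rε = (2/r)ε, as 2√3 r² = 1. -/
theorem perimeter_openHexagon_le (θ : ℝ) (c : EuclideanSpace ℝ (Fin 2)) :
    perimeter (openHexagon θ hexApothem c) ≤ ENNReal.ofReal (2 / hexApothem) := by
  have hr := hexApothem_pos
  set r := hexApothem with hrdef
  have hne : (openHexagon θ r c)ᶜ.Nonempty := by
    refine ⟨c + r • hexDir θ 0, fun h => ?_⟩
    have := h 0
    simp [inner_smul_right, norm_hexDir] at this
  refine perimeter_le_of_volume_infDist_lt (isOpen_openHexagon _ _ _) hne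
    (ε := fun n => r * (1 / 2) ^ (n + 1)) (c := fun _ => 2 / r) (fun n => by positivity) ?_
    (fun _ => by positivity) tendsto_const_nhds fun n => ?_
  · have h1 : Tendsto (fun n : ℕ => ((1 : ℝ) / 2) ^ (n + 1)) atTop (𝓝 0) :=
      (tendsto_add_atTop_iff_nat 1).2 (tendsto_pow_atTop_nhds_zero_of_lt_one (by norm_num) (by norm_num))
    simpa using h1.const_mul r
  · have hlt : r * ((1 : ℝ) / 2) ^ (n + 1) < r :=
      mul_lt_of_lt_one_right hr (pow_lt_one₀ (by norm_num) (by norm_num) (by simp))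
    have hpos : 0 < r * ((1 : ℝ) / 2) ^ (n + 1) := by positivity
    generalize r * ((1 : ℝ) / 2) ^ (n + 1) = ε at hlt hpos
    have hsub : {x | x ∈ openHexagon θ r c ∧ Metric.infDist x (openHexagon θ r c)ᶜ < ε} ⊆
        openHexagon θ r c \ openHexagon θ (r - ε) c := by
      rintro x ⟨hx, hd⟩
      refine ⟨hx, fun hx' => ?_⟩
      obtain ⟨y, hy, hxy⟩ := (Metric.infDist_lt_iff hne).1 hd
      refine hy fun j => ?_
      have h1 := hx' j
      have h2 := real_inner_le_norm (hexDir θ j) (y - x)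
      rw [norm_hexDir, one_mul, ← dist_eq_norm, dist_comm] at h2
      have h3 : ⟪hexDir θ j, y - c⟫_ℝ = ⟪hexDir θ j, y - x⟫_ℝ + ⟪hexDir θ j, x - c⟫_ℝ := by
        rw [← inner_add_right, sub_add_sub_cancel]
      linarith
    refine (measure_mono hsub).trans ?_
    rw [measure_sdiff (fun x hx j => (hx j).trans (by linarith))
      (isOpen_openHexagon _ _ _).measurableSet.nullMeasurableSet
      (by rw [volume_openHexagon (by linarith)]; exact ENNReal.ofReal_ne_top),
      volume_openHexagon hr, volume_openHexagon (by linarith),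
      ← ENNReal.ofReal_sub _ (by positivity)]
    refine ENNReal.ofReal_le_ofReal ?_
    have h1 := hexApothem_sq
    rw [← hrdef] at h1
    have h2 : 2 / r = 2 * (2 * √3 * r) := by
      rw [div_eq_iff hr.ne']; linarith
    have h3 : 0 < √3 := by positivity
    rw [h2]
    nlinarith [mul_pos h3 (pow_pos hpos 2)]

theorem cos_mul_pi_div_three_le {n : ℤ} (h0 : n ≠ 0) (h1 : |n| ≤ 5) :
    Real.cos ((n : ℝ) * (Real.pi / 3)) ≤ 1 / 2 := by
  have hpi := Real.pi_pos
  have h2 : (1 : ℝ) ≤ |(n : ℝ)| := by exact_mod_cast Int.one_le_abs h0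
  have h3 : |(n : ℝ)| ≤ 5 := by exact_mod_cast h1
  rw [← Real.cos_abs, abs_mul, abs_of_pos (by positivity : 0 < Real.pi / 3)]
  have hlo : Real.pi / 3 ≤ |(n : ℝ)| * (Real.pi / 3) := by nlinarith
  have hhi : |(n : ℝ)| * (Real.pi / 3) ≤ 5 * (Real.pi / 3) := by gcongr
  rw [← Real.cos_pi_div_three]
  rcases le_total (|(n : ℝ)| * (Real.pi / 3)) Real.pi with h | h
  · exact Real.cos_le_cos_of_nonneg_of_le_pi (by positivity) h hlo
  · rw [← Real.cos_two_pi_sub]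
    exact Real.cos_le_cos_of_nonneg_of_le_pi (by positivity) (by linarith) (by linarith)

/-- Interior points of a side satisfy the other five constraints strictly. Since sin² = (1 - cos)(1
+ cos), it suffices that (1 + cos)t² < (1 - cos)r², and 1 + cos ≤ 3(1 - cos) when cos ≤ 1/2. -/
theorem cos_mul_add_sin_mul_lt {r t x : ℝ} (hr : 0 < r) (ht : 3 * t ^ 2 < r ^ 2)
    (hx : Real.cos x ≤ 1 / 2) : Real.cos x * r + Real.sin x * t < r := by
  have h1 := Real.sin_sq_add_cos_sq x
  have h2 : (Real.sin x * t) ^ 2 < ((1 - Real.cos x) * r) ^ 2 := by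
    have h3 : Real.sin x ^ 2 = (1 - Real.cos x) * (1 + Real.cos x) := by linarith
    have h4 : 0 < 1 - Real.cos x := by linarith
    have h5 : (1 + Real.cos x) * t ^ 2 < (1 - Real.cos x) * r ^ 2 := by
      nlinarith [sq_nonneg t, Real.neg_one_le_cos x]
    rw [mul_pow, mul_pow, h3]
    nlinarith [mul_lt_mul_of_pos_left h5 h4]
  have h6 := abs_lt_of_sq_lt_sq h2 (by nlinarith)
  linarith [le_abs_self (Real.sin x * t), abs_lt.1 h6]

/-- The boundary contains six disjoint open segments of length 2r/√3, of total length 12r/√3 = 2/r.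
Only this lower bound is needed, since `hexLength` serves as an upper bound for perimeters. -/
theorem le_hexLength : ENNReal.ofReal (2 / hexApothem) ≤ hexLength := by
  have hr := hexApothem_pos
  set r := hexApothem with hrdef
  have h3 : 0 < √3 := by positivity
  have h33 : √3 ^ 2 = 3 := Real.sq_sqrt (by norm_num)
  set γ : Fin 6 → ℝ → EuclideanSpace ℝ (Fin 2) :=
    fun j t => r • hexDir 0 j + t • hexDir (Real.pi / 2) j with hγ
  have hiso : ∀ j, Isometry (γ j) := fun j => Isometry.of_dist_eq fun s t => by
    rw [dist_eq_norm, show γ j s - γ j t = (s - t) • hexDir (Real.pi / 2) j by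
      simp only [hγ]; module, norm_smul, norm_hexDir, mul_one, Real.dist_eq, Real.norm_eq_abs]
  have hin : ∀ i j : Fin 6, ∀ t, ⟪hexDir 0 i, γ j t⟫_ℝ =
      Real.cos (((i : ℝ) - j) * (Real.pi / 3)) * r + Real.sin (((i : ℝ) - j) * (Real.pi / 3)) * t := by
    intro i j t
    simp only [hγ, inner_add_right, inner_smul_right, inner_hexDir_hexDir]
    rw [sub_self, zero_add, zero_sub, ← Real.cos_sub_pi_div_two]
    ring_nf
  have hself : ∀ (j : Fin 6) t, ⟪hexDir 0 j, γ j t⟫_ℝ = r := fun j t => by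
    rw [hin]; simp
  have hlt : ∀ i j : Fin 6, i ≠ j → ∀ t ∈ Set.Ioo (-(r / √3)) (r / √3), ⟪hexDir 0 i, γ j t⟫_ℝ < r := by
    intro i j hij t ht
    rw [hin]
    have hn : ((((i : ℕ) : ℤ) - ((j : ℕ) : ℤ) : ℤ) : ℝ) = (i : ℝ) - j := by push_cast; rfl
    rw [← hn]
    refine cos_mul_add_sin_mul_lt hr ?_ (cos_mul_pi_div_three_le ?_ ?_)
    · have h1 : t ^ 2 < (r / √3) ^ 2 := sq_lt_sq' ht.1 ht.2
      rw [div_pow, h33] at h1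
      linarith
    · intro h
      exact hij (Fin.ext (by omega))
    · have := i.2
      have := j.2
      rw [abs_le]
      omega
  set S : Fin 6 → Set (EuclideanSpace ℝ (Fin 2)) :=
    fun j => γ j '' Set.Ioo (-(r / √3)) (r / √3) with hS
  have hSd : Pairwise (Function.onFun Disjoint S) := by
    intro i j hij
    refine Set.disjoint_left.2 ?_
    rintro _ ⟨s, hs, rfl⟩ ⟨t, ht, hst⟩
    have h1 := hself i s
    rw [← hst] at h1
    exact (hlt i j hij t ht).ne h1
  have hSm : ∀ j, MeasurableSet (S j) := fun j =>
    (hiso j).isClosedEmbedding.measurableEmbedding.measurableSet_image.2 measurableSet_Ioo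
  have hSv : ∀ j, Measure.hausdorffMeasure 1 (S j) = ENNReal.ofReal (2 * (r / √3)) := by
    intro j
    rw [hS, (hiso j).hausdorffMeasure_image (Or.inl zero_le_one), hausdorffMeasure_real, Real.volume_Ioo]
    congr 1; ring
  have hsub : (⋃ j, S j) ⊆ frontier (hexagon 0 0) := by
    refine Set.iUnion_subset fun j => ?_
    rintro _ ⟨t, ht, rfl⟩
    refine ⟨subset_closure fun i => ?_, fun hmem => ?_⟩
    · rw [sub_zero]
      rcases eq_or_ne i j with rfl | hij
      · exact (hself i t).le
      · exact (hlt i j hij t ht).le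
    · obtain ⟨ε, hε, hball⟩ := Metric.mem_nhds_iff.1 (mem_interior_iff_mem_nhds.1 hmem)
      have h1 : γ j t + (ε / 2) • hexDir 0 j ∈ hexagon 0 0 := hball (by
        rw [Metric.mem_ball, dist_eq_norm, add_sub_cancel_left, norm_smul, norm_hexDir, mul_one,
          Real.norm_of_nonneg (by positivity)]
        linarith)
      have h2 := h1 j
      rw [sub_zero, inner_add_right, hself, inner_smul_right, real_inner_self_eq_norm_sq,
        norm_hexDir] at h2
      linarith
  refine le_trans (le_of_eq ?_) (measure_mono hsub)
  have hu := measure_iUnion (μ := Measure.hausdorffMeasure 1) hSd hSm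
  rw [tsum_fintype] at hu
  simp only [hSv, Finset.sum_const, Finset.card_univ, Fintype.card_fin] at hu
  rw [hu, ← ENNReal.ofReal_nsmul]
  congr 1
  have h1 := hexApothem_sq
  rw [← hrdef] at h1
  simp only [nsmul_eq_mul]
  field_simp
  push_cast
  nlinarith

/-- The centre of the tile of index `p`. -/
noncomputable def hexCenter (θ : ℝ) (c : EuclideanSpace ℝ (Fin 2)) (p : ℤ × ℤ) : EuclideanSpace ℝ (Fin 2) :=
  c + (2 * hexApothem) • ((p.1 : ℝ) • hexDir θ 0 + (p.2 : ℝ) • hexDir θ 1)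

/-- Centres have coordinates u, v, v - u equal to r times 2p₁ + p₂, p₁ + 2p₂, p₂ - p₁, up to a
common shift. A common point makes each of these integers differ by less than 2 between p and q,
hence by at most 1, which forces p = q. -/
theorem disjoint_openHexagon_hexCenter (θ : ℝ) (c : EuclideanSpace ℝ (Fin 2)) {p q : ℤ × ℤ}
    (hpq : p ≠ q) : Disjoint (openHexagon θ hexApothem (hexCenter θ c p))
      (openHexagon θ hexApothem (hexCenter θ c q)) := by
  refine Set.disjoint_left.2 fun x hp hq => hpq ?_
  have hr := hexApothem_pos
  rw [mem_openHexagon_iff] at hp hq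
  simp only [abs_lt] at hp hq
  have h01 : ⟪hexDir θ 0, hexDir θ 1⟫_ℝ = 1 / 2 := by
    rw [inner_hexDir_hexDir, ← Real.cos_neg]
    simp
  have h10 : ⟪hexDir θ 1, hexDir θ 0⟫_ℝ = 1 / 2 := by rw [real_inner_comm]; exact h01
  have e0 : ∀ p : ℤ × ℤ, ⟪hexDir θ 0, x - hexCenter θ c p⟫_ℝ =
      ⟪hexDir θ 0, x - c⟫_ℝ - hexApothem * (2 * p.1 + p.2) := by
    intro p
    simp only [hexCenter, ← sub_sub, inner_sub_right _ (x - c), inner_smul_right, inner_add_right, h01,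
      real_inner_self_eq_norm_sq, norm_hexDir]
    ring
  have e1 : ∀ p : ℤ × ℤ, ⟪hexDir θ 1, x - hexCenter θ c p⟫_ℝ =
      ⟪hexDir θ 1, x - c⟫_ℝ - hexApothem * (p.1 + 2 * p.2) := by
    intro p
    simp only [hexCenter, ← sub_sub, inner_sub_right _ (x - c), inner_smul_right, inner_add_right, h10,
      real_inner_self_eq_norm_sq, norm_hexDir]
    ring
  simp only [e0, e1] at hp hq
  obtain ⟨⟨a1, a2⟩, ⟨a3, a4⟩, a5, a6⟩ := hp
  obtain ⟨⟨b1, b2⟩, ⟨b3, b4⟩, b5, b6⟩ := hq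
  have key : ∀ n : ℤ, hexApothem * n < 2 * hexApothem → n ≤ 1 := by
    intro n hn
    have : (n : ℝ) < 2 := by
      rw [mul_comm] at hn
      exact lt_of_mul_lt_mul_right hn hr.le
    have : n < 2 := by exact_mod_cast this
    omega
  have k1 := key ((2 * p.1 + p.2) - (2 * q.1 + q.2)) (by push_cast; linarith)
  have k2 := key ((2 * q.1 + q.2) - (2 * p.1 + p.2)) (by push_cast; linarith)
  have k3 := key ((p.1 + 2 * p.2) - (q.1 + 2 * q.2)) (by push_cast; linarith)
  have k4 := key ((q.1 + 2 * q.2) - (p.1 + 2 * p.2)) (by push_cast; linarith)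
  have k5 := key ((p.2 - p.1) - (q.2 - q.1)) (by push_cast; linarith)
  have k6 := key ((q.2 - q.1) - (p.2 - p.1)) (by push_cast; linarith)
  exact Prod.ext (by omega) (by omega)

theorem isBounded_hexagon (θ : ℝ) (c : EuclideanSpace ℝ (Fin 2)) :
    Bornology.IsBounded (hexagon θ c) := by
  refine Metric.isBounded_closedBall.subset (t := Metric.closedBall c (2 * hexApothem)) fun x hx => ?_
  have hr := hexApothem_pos
  have h33 : √3 ^ 2 = 3 := Real.sq_sqrt (by norm_num)
  -- In these coordinates |x - c|² = u² + (2v - u)²/3, with |u| ≤ r and |2v - u| ≤ 3r, whence the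
  -- radius 2r.
  have hnorm : ‖x - c‖ ^ 2 = ⟪hexDir θ 0, x - c⟫_ℝ ^ 2 +
      (2 * ⟪hexDir θ 1, x - c⟫_ℝ - ⟪hexDir θ 0, x - c⟫_ℝ) ^ 2 / 3 := by
    rw [EuclideanSpace.norm_sq_eq]
    simp only [hexDir, PiLp.inner_apply, Fin.sum_univ_two, Nat.cast_zero, Nat.cast_one, zero_mul,
      add_zero, one_mul, Real.cos_add, Real.sin_add, Real.cos_pi_div_three, Real.sin_pi_div_three,
      Real.norm_eq_abs, sq_abs, RCLike.inner_apply, conj_trivial, Matrix.cons_val_zero,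
      Matrix.cons_val_one]
    have hsc := Real.sin_sq_add_cos_sq θ
    generalize (x - c).ofLp 0 = a
    generalize (x - c).ofLp 1 = b
    linear_combination (-(a ^ 2 + b ^ 2)) * hsc -
      ((b * Real.cos θ - a * Real.sin θ) ^ 2 / 3) * h33
  have h3 := hexDir_add_three θ 0
  have h4 := hexDir_add_three θ 1
  norm_num at h3 h4
  have a0 := hx 0
  have a1 := hx 1
  have a3 := hx 3
  have a4 := hx 4
  simp [h3, h4] at a0 a1 a3 a4
  rw [Metric.mem_closedBall, dist_eq_norm]
  refine abs_le_of_sq_le_sq' ?_ (by positivity) |>.2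
  rw [hnorm]
  have b0 : ⟪hexDir θ 0, x - c⟫_ℝ ^ 2 ≤ hexApothem ^ 2 := sq_le_sq' (by linarith) a0
  have b1 : (2 * ⟪hexDir θ 1, x - c⟫_ℝ - ⟪hexDir θ 0, x - c⟫_ℝ) ^ 2 ≤ (3 * hexApothem) ^ 2 :=
    sq_le_sq' (by linarith) (by linarith)
  nlinarith

end Hexagons

/-! ### k-cells and the conclusion -/

section Cells

theorem isBounded_hexRegion (θ : ℝ) (c : EuclideanSpace ℝ (Fin 2)) (s : Finset (ℤ × ℤ)) :
    Bornology.IsBounded (hexRegion θ c s) :=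
  ((Bornology.isBounded_biUnion_finset s).2 fun _ _ => isBounded_hexagon θ _).subset
    interior_subset

theorem openHexagon_subset_hexRegion (θ : ℝ) (c : EuclideanSpace ℝ (Fin 2)) {s : Finset (ℤ × ℤ)}
    {p : ℤ × ℤ} (hp : p ∈ s) :
    openHexagon θ hexApothem (hexCenter θ c p) ⊆ hexRegion θ c s :=
  interior_maximal ((openHexagon_subset_hexagon θ _).trans
    (Set.subset_biUnion_of_mem (u := fun p => hexTile θ c p) hp)) (isOpen_openHexagon _ _ _)

/-- Closed tiles of area at most 1 bound the volume above, disjoint open tiles of area 1 bound it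
below; no description of the common edges is required. -/
theorem volume_hexRegion (θ : ℝ) (c : EuclideanSpace ℝ (Fin 2)) (s : Finset (ℤ × ℤ)) :
    volume (hexRegion θ c s) = s.card := by
  apply le_antisymm
  · calc volume (hexRegion θ c s) ≤ volume (⋃ p ∈ s, hexTile θ c p) := measure_mono interior_subset
      _ ≤ ∑ p ∈ s, volume (hexTile θ c p) := measure_biUnion_finset_le _ _
      _ ≤ ∑ p ∈ s, 1 := Finset.sum_le_sum fun p _ => volume_hexagon_le θ _
      _ = s.card := by simp
  · calc (s.card : ℝ≥0∞) = ∑ p ∈ s, volume (openHexagon θ hexApothem (hexCenter θ c p)) := by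
          simp [volume_openHexagon_hexApothem]
      _ = volume (⋃ p ∈ s, openHexagon θ hexApothem (hexCenter θ c p)) :=
          (measure_biUnion_finset (fun p _ q _ hpq => disjoint_openHexagon_hexCenter θ c hpq)
            fun p _ => (isOpen_openHexagon _ _ _).measurableSet).symm
      _ ≤ volume (hexRegion θ c s) :=
          measure_mono (Set.iUnion₂_subset fun p hp => openHexagon_subset_hexRegion θ c hp)

theorem exists_isEqualPartition_of_isKCell {k : ℕ} {D : Set (EuclideanSpace ℝ (Fin 2))}
    (hD : IsKCell k D) {α : ℕ → ℝ} {Ω : ℕ → Fin k → Set (EuclideanSpace ℝ (Fin 2))}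
    (hα : Tendsto α atTop atTop) (hΩ : ∀ n, IsMaxSolution (α n) D (Ω n)) :
    ∃ (φ : ℕ → ℕ) (E : Fin k → Set (EuclideanSpace ℝ (Fin 2))),
      StrictMono φ ∧ TendstoL1 D (fun n => Ω (φ n)) E ∧ IsEqualPartition D E ∧
      (∀ i, volume (E i) = 1) ∧ ∏ i, perimeter (E i) ≤ hexLength ^ k := by
  obtain ⟨θ, c, s, hs, rfl, hconn⟩ := hD
  have hvol : volume (hexRegion θ c s) = k := by rw [volume_hexRegion, hs]
  -- Connectedness includes nonemptiness, so there is at least one tile.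
  have hk : 0 < k := by
    obtain ⟨x, hx⟩ := hconn.nonempty
    obtain ⟨p, hp, -⟩ := Set.mem_iUnion₂.1 (interior_subset hx)
    exact hs ▸ Finset.card_pos.2 ⟨p, hp⟩
  have hk0 : (k : ℝ≥0∞) ≠ 0 := by exact_mod_cast hk.ne'
  have hone : volume (hexRegion θ c s) / k = 1 := by
    rw [hvol, ENNReal.div_self hk0 (ENNReal.natCast_ne_top k)]
  let e : Fin k ≃ s := (s.equivFinOfCardEq hs).symm
  obtain ⟨φ, E, hφ, hL, hE, hP⟩ := exists_tendstoL1_isEqualPartition two_pos hk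
    (D := hexRegion θ c s) isOpen_interior.measurableSet (isBounded_hexRegion θ c s)
    (by rw [hvol]; exact hk0) (C := 2 / hexApothem)
    (F := fun i => openHexagon θ hexApothem (hexCenter θ c (e i)))
    ⟨fun i => openHexagon_subset_hexRegion θ c (e i).2,
      fun i j hij => disjoint_openHexagon_hexCenter θ c
        fun h => hij (e.injective (Subtype.ext h)),
      fun i => (isOpen_openHexagon _ _ _).measurableSet⟩
    (fun i => by rw [volume_openHexagon_hexApothem, hone])
    (fun i => perimeter_openHexagon_le θ _) hα hΩ
  exact ⟨φ, E, hφ, hL, hE, fun i => (hE.2.2 i).trans hone, hP.trans (by gcongr; exact le_hexLength)⟩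

end Cells


theorem proposition1p3 :
    -- Convergence, up to subsequences, to an equal-measure partition.
    (∀ (N k : ℕ), 2 ≤ N → 1 ≤ k →
      ∀ D : Set (EuclideanSpace ℝ (Fin N)),
        IsOpen D → Bornology.IsBounded D → HasLipschitzBoundary D →
      ∀ (α : ℕ → ℝ) (Ω : ℕ → Fin k → Set (EuclideanSpace ℝ (Fin N))),
        Tendsto α atTop atTop →
        (∀ n, ((N : ℝ) - 1) / N < α n) →
        (∀ n, IsMaxSolution (α n) D (Ω n)) →
        ∃ (φ : ℕ → ℕ) (E : Fin k → Set (EuclideanSpace ℝ (Fin N))),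
          StrictMono φ ∧ TendstoL1 D (fun n => Ω (φ n)) E ∧ IsEqualPartition D E) ∧
    -- The planar case of a `k`-cell.
    (∀ (k : ℕ) (D : Set (EuclideanSpace ℝ (Fin 2))), IsKCell k D →
      ∀ (α : ℕ → ℝ) (Ω : ℕ → Fin k → Set (EuclideanSpace ℝ (Fin 2))),
        Tendsto α atTop atTop →
        (∀ n, (1 : ℝ) / 2 < α n) →
        (∀ n, IsMaxSolution (α n) D (Ω n)) →
        ∃ (φ : ℕ → ℕ) (E : Fin k → Set (EuclideanSpace ℝ (Fin 2))),
          StrictMono φ ∧ TendstoL1 D (fun n => Ω (φ n)) E ∧ IsEqualPartition D E ∧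
          (ProductHoneycomb k D →
            -- the limit is optimal, with the optimal value of the hexagonal partition,
            IsProductMinimizer D E ∧ ∏ i, perimeter (E i) = hexLength ^ k ∧
            -- hence is the hexagonal one if this is the only optimal partition.
            ((∀ F : Fin k → Set (EuclideanSpace ℝ (Fin 2)),
                IsProductMinimizer D F → IsHexagonalPartition D F) →
              IsHexagonalPartition D E))) := by
  refine ⟨fun N k hN hk D hDo hDb hDL α Ω hα _ hΩ => ?_, fun k D hD α Ω hα _ hΩ => ?_⟩
  -- The empty domain is allowed and treated apart; a nonempty open D has positive volume.
  · rcases D.eq_empty_or_nonempty with rfl | hDne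
    · have h0 : ∀ n i, Ω n i = ∅ := fun n i => Set.subset_empty_iff.1 ((hΩ n).1.1 i)
      refine ⟨id, fun _ => ∅, strictMono_id, fun i => by simp [h0],
        ⟨fun i => subset_rfl, fun i j _ => disjoint_bot_left, fun i => MeasurableSet.empty⟩,
        by simp, fun i => by simp⟩
    · have hD0 : volume D ≠ 0 := (hDo.measure_pos volume hDne).ne'
      obtain ⟨F, C, hF, hFv, hFp⟩ :=
        exists_isCluster_equal_volume_perimeter_le (by omega) hk hDo hDb hD0 hDL
      obtain ⟨φ, E, hφ, hL, hE, -⟩ := exists_tendstoL1_isEqualPartition (by omega) hk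
        hDo.measurableSet hDb hD0 hF hFv hFp hα hΩ
      exact ⟨φ, E, hφ, hL, hE⟩
  · obtain ⟨φ, E, hφ, hL, hE, hE1, hP⟩ := exists_isEqualPartition_of_isKCell hD hα hΩ
    refine ⟨φ, E, hφ, hL, hE, fun hhoney => ?_⟩
    have hunit : IsUnitCluster D E := ⟨hE.1, hE1⟩
    have hmin : IsProductMinimizer D E :=
      ⟨hunit, fun Ω' hΩ' => hP.trans (hhoney.2 ⟨Ω', hΩ', rfl⟩)⟩
    exact ⟨hmin, le_antisymm hP (hhoney.2 ⟨E, hunit, rfl⟩), fun huniq => huniq E hmin⟩
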